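/- Let $Y$ be a path-connected, locally simply connected topological space, with universal covering $\pi:X\to Y$ and fundamental group $\Gamma$, acting on $X$ by deck transformations. Let $C\to Y$ be a normal covering ($C$ path-connected), let $\Sigma\subset\Gamma$ be the normal subgroup given by the fundamental group of $C$, and let $R$ be a commutative ring with unit. Let $I$ and $I_\Sigma$ be the augmentation ideals of $A=R[\Gamma]$ and of $R[\Sigma]$. For $q\ge 1$ put $J_q=I^q+A I_\Sigma$. For an $A$-module $V$ put $H_q^0(\Gamma,\Sigma,V)=\operatorname{Hom}_A(A/J_q,V)$, and for a sheaf $\mathcal F$ of $R$-modules on $Y$ put $$H_q^0(Y,C,\mathcal F)=H_q^0\bigl(\Gamma,\Sigma,H^0(X,\pi^*\mathcal F)\bigr).$$ Let $H_q^p(Y,C,\cdot)$, $p\ge 0$, be the right derived functors of the left exact functor $H_q^0(Y,C,\cdot)$ from sheaves of $R$-modules on $Y$ to $R$-modules, and let $H^p(Y,\cdot)$ be those of the global sections functor $H^0(Y,\cdot)$. A sheaf $\mathcal F$ is called acyclic for a left exact functor $T$ if $R^pT(\mathcal F)=0$ for all $p\ge 1$. Assume that $X$ is contractible. (a) For each $p\ge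 0$ there is an isomorphism $H_1^p(Y,C,\mathcal F)\cong H^p(Y,\mathcal F)$ of $R$-modules, natural in $\mathcal F$. Let now $q\ge 1$ be such that the $R$-modules $J_k/J_{k+1}$, $1\le k<q$, are free (for instance, any $q\ge1$ if $R$ is a field). (b) Every sheaf of $R$-modules $\mathcal F$ on $Y$ that is $H^0(Y,\cdot)$-acyclic is $H_q^0(Y,C,\cdot)$-acyclic. (c) Flabby or fine resolutions compute higher order cohomology: if $0\to\mathcal F\to\mathcal K^0\to\mathcal K^1\to\cdots$ is a resolution of a sheaf of $R$-modules $\mathcal F$ on $Y$ such that either all $\mathcal K^n$ are flabby, or $Y$ is paracompact Hausdorff and all $\mathcal K^n$ are fine, then for each $p\ge 0$ the $R$-module $H_q^p(Y,C,\mathcal F)$ is isomorphic to the $p$-th cohomology of the complex $H_q^0(Y,C,\mathcal K^\bullet)$. Here a sheaf $\mathcal K$ is fine if for every locally finite open cover $(U_i)$ of $Y$ there are endomorphisms $h_i$ of $\mathcal K$ with (closed) support contained in $U_i$ and $\sum_i h_i=\mathrm{id}$. -/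

import Mathlib

open CategoryTheory TopologicalSpace Opposite

universe u

namespace HigherOrder

noncomputable section

/-! ### Group algebras and the ideals `J_q` -/

section Algebra

variable (R : Type u) [CommRing R] {Γ : Type u} [Group Γ]

/-- The augmentation ideal of `R[Γ]`: the kernel of `R[Γ] → R`, `γ ↦ 1`. -/
def augmentationIdeal (Γ : Type u) [Group Γ] : Ideal (MonoidAlgebra R Γ) :=
  RingHom.ker (MonoidAlgebra.lift R R Γ (1 : Γ →* R))

/-- The ideal `J_q = I ^ q + R[Γ] I_Σ`, where `I` and `I_Σ` are the augmentation ideals of `R[Γ]`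
and of `R[Σ]`. The second summand is the left ideal generated by the image of `I_Σ`. -/
def idealJ (S : Subgroup Γ) (q : ℕ) : Ideal (MonoidAlgebra R Γ) :=
  augmentationIdeal R Γ ^ q +
    (augmentationIdeal R S).map (MonoidAlgebra.mapDomainRingHom R S.subtype)

/-- The `R`-module `J_q / J_{q+1}`. -/
abbrev gradedJ (S : Subgroup Γ) (q : ℕ) : Type u :=
  ↥((idealJ R S q).restrictScalars R) ⧸
    ((idealJ R S (q + 1)).restrictScalars R).submoduleOf ((idealJ R S q).restrictScalars R)

/-- The functor `H_q^0(Γ, Σ, V) = Hom_A(A / J_q, V)` with `A = R[Γ]`, from `R[Γ]`-modules, that is,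
representations of `Γ` on `R`-modules, to `R`-modules. -/
def groupH0 (S : Subgroup Γ) (q : ℕ) : Rep.{u} R Γ ⥤ ModuleCat.{u} R :=
  (linearCoyoneda R (Rep.{u} R Γ)).obj
    (op (Rep.ofModuleMonoidAlgebra.obj
      (ModuleCat.of (MonoidAlgebra R Γ) (MonoidAlgebra R Γ ⧸ idealJ R S q))))

instance (S : Subgroup Γ) (q : ℕ) : (groupH0 R S q).Additive :=
  linearCoyoneda_obj_additive R _ _

end Algebra

/-! ### Coverings -/

section Coverings

/-- Every point has arbitrarily small simply connected neighbourhoods. -/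
def LocallySimplyConnected (Y : Type u) [TopologicalSpace Y] : Prop :=
  ∀ y : Y, ∀ U ∈ nhds y, ∃ V ∈ nhds y, V ⊆ U ∧ IsSimplyConnected V

/-- A covering map with simply connected total space. -/
structure IsUniversalCovering {X Y : Type u} [TopologicalSpace X] [TopologicalSpace Y]
    (π : X → Y) : Prop where
  isCoveringMap : IsCoveringMap π
  simplyConnected : SimplyConnectedSpace X

/-- The group of deck transformations of `π : X → Y`. If `π` is the universal covering, then
this is the fundamental group of `Y`, with its action on `X`. -/
def deck {X Y : Type u} [TopologicalSpace X] (π : X → Y) : Subgroup (X ≃ₜ X) where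
  carrier := {g | ∀ x, π (g x) = π x}
  one_mem' _ := rfl
  mul_mem' {g h} hg hh x := (hg (h x)).trans (hh x)
  inv_mem' {g} hg x := by
    have h := hg (g⁻¹ x)
    rw [show g (g⁻¹ x) = x from g.apply_symm_apply x] at h
    exact h.symm

/-- A normal (also called regular or Galois) covering: a covering map with path-connected total
space whose deck transformations act transitively on each fibre. -/
structure IsNormalCovering {C Y : Type u} [TopologicalSpace C] [TopologicalSpace Y]
    (p : C → Y) : Prop where
  isCoveringMap : IsCoveringMap p
  pathConnected : PathConnectedSpace C
  exists_deck : ∀ c c' : C, p c = p c' → ∃ g ∈ deck p, g c = c'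

/-- The deck transformations of `π : X → Y` that are deck transformations of `ρ : X → C`, where
`π` factors through `ρ`. If `X` is simply connected, then this is the fundamental group of `C`,
as a subgroup of that of `Y`. -/
def deckOver {X C Y : Type u} [TopologicalSpace X] (π : X → Y) (ρ : X → C) : Subgroup (deck π) :=
  (deck ρ).subgroupOf (deck π)

end Coverings

/-! ### Global sections of the inverse image of a sheaf, and higher order cohomology -/

section Sheaves

variable {R : Type u} [CommRing R] {Y : TopCat.{u}} {X : Type u} [TopologicalSpace X]

/-- A family `s` of germs: for every `x : X` an element `s (π x) ⟨x, rfl⟩` of `F_{π x}`, the stalk at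
`x` of the inverse image of `F`. The index `x` of the family runs over the fibres of `π`. -/
abbrev GermFamily (π : X → Y) (F : TopCat.Sheaf (ModuleCat.{u} R) Y) : Type u :=
  ∀ y : Y, {x : X // π x = y} → F.presheaf.stalk y

/-- The map from `X` to the étalé space of `F` that a family of germs defines. -/
def toEtale {π : X → Y} {F : TopCat.Sheaf (ModuleCat.{u} R) Y} (s : GermFamily π F) (x : X) :
    F.presheaf.EtaleSpace :=
  ⟨π x, s (π x) ⟨x, rfl⟩⟩

/-- A family of germs is continuous if and only if it is locally on `X` given by sections
of `F`. -/
theorem continuous_toEtale_iff {π : X → Y} (hπ : Continuous π)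
    {F : TopCat.Sheaf (ModuleCat.{u} R) Y} (s : GermFamily π F) :
    Continuous (toEtale s) ↔ ∀ x : X, ∃ (U : Opens Y) (_ : π x ∈ U) (t : F.presheaf.obj (op U)),
      ∀ᶠ x' in nhds x, ∃ h : π x' ∈ U, s (π x') ⟨x', rfl⟩ = F.presheaf.germ U (π x') h t := by
  constructor
  · intro hs x
    obtain ⟨U, hU, t, ht⟩ := TopCat.Presheaf.EtaleSpace.exists_section_of_tendsto (hs.tendsto x)
    exact ⟨U, hU, t, ht⟩
  · intro hs
    rw [continuous_generateFrom_iff]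
    rintro _ ⟨V, f, rfl⟩
    rw [isOpen_iff_mem_nhds]
    rintro x ⟨hxV, hx⟩
    obtain ⟨U, hU, t, ht⟩ := hs x
    obtain ⟨hU', ht'⟩ := ht.self_of_nhds
    obtain ⟨W, hxW, i, j, hW⟩ := F.presheaf.germ_eq (π x) hU' hxV t f (ht'.symm.trans hx)
    filter_upwards [ht, (W.isOpen.preimage hπ).mem_nhds hxW] with z hz hzW
    obtain ⟨hzU, hz⟩ := hz
    refine ⟨j.le hzW, hz.trans ?_⟩
    show _ = F.presheaf.germ V (π z) _ f
    rw [← F.presheaf.germ_res_apply i (π z) hzW, hW, F.presheaf.germ_res_apply]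

/-- `H^0(X, π^* F)`: the inverse image `π^* F` is the sheaf of continuous lifts of `π` to the étalé
space of `F`, so its global sections are the families of germs of `F` that are continuous as
maps from `X` to the étalé space. -/
def pullbackSections (π : C(X, Y)) (F : TopCat.Sheaf (ModuleCat.{u} R) Y) :
    Submodule R (GermFamily π F) where
  carrier := {s | Continuous (toEtale s)}
  zero_mem' := (continuous_toEtale_iff π.continuous _).2 fun x =>
    ⟨⊤, trivial, 0, .of_forall fun x' => ⟨trivial, (map_zero _).symm⟩⟩
  add_mem' {a b} ha hb := (continuous_toEtale_iff π.continuous _).2 fun x => by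
    obtain ⟨U, hU, t, ht⟩ := (continuous_toEtale_iff π.continuous _).1 ha x
    obtain ⟨V, hV, r, hr⟩ := (continuous_toEtale_iff π.continuous _).1 hb x
    refine ⟨U ⊓ V, ⟨hU, hV⟩, F.presheaf.map (homOfLE inf_le_left).op t +
      F.presheaf.map (homOfLE inf_le_right).op r, ?_⟩
    filter_upwards [ht, hr] with x' ⟨h1, e1⟩ ⟨h2, e2⟩
    refine ⟨⟨h1, h2⟩, ?_⟩
    refine Eq.trans ?_ (map_add _ _ _).symm
    refine (congrArg₂ (· + ·) e1 e2).trans (congrArg₂ (· + ·) ?_ ?_)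
    · exact (F.presheaf.germ_res_apply (homOfLE inf_le_left) (π x') ⟨h1, h2⟩ t).symm
    · exact (F.presheaf.germ_res_apply (homOfLE inf_le_right) (π x') ⟨h1, h2⟩ r).symm
  smul_mem' c a ha := (continuous_toEtale_iff π.continuous _).2 fun x => by
    obtain ⟨U, hU, t, ht⟩ := (continuous_toEtale_iff π.continuous _).1 ha x
    refine ⟨U, hU, c • t, ?_⟩
    filter_upwards [ht] with x' ⟨h1, e1⟩
    refine ⟨h1, ?_⟩
    exact (congrArg (c • ·) e1).trans (map_smul _ _ _).symm

/-- The action of a deck transformation `g` on families of germs: `(g s)(x) = s(g⁻¹ x)`, an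
equation in the stalk of `F` at `π x = π (g⁻¹ x)`. -/
def germAction (π : X → Y) (F : TopCat.Sheaf (ModuleCat.{u} R) Y) (g : deck π) :
    GermFamily π F →ₗ[R] GermFamily π F where
  toFun s y x := s y ⟨g.1⁻¹ x.1, (g⁻¹.2 x.1).trans x.2⟩
  map_add' _ _ := rfl
  map_smul' _ _ := rfl

theorem toEtale_germAction (π : X → Y) (F : TopCat.Sheaf (ModuleCat.{u} R) Y) (g : deck π)
    (s : GermFamily π F) (x : X) : toEtale (germAction π F g s) x = toEtale s (g.1⁻¹ x) := by
  have key : ∀ (y : Y) (x' : X) (h : π x' = y),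
      (⟨y, s y ⟨x', h⟩⟩ : F.presheaf.EtaleSpace) = ⟨π x', s (π x') ⟨x', rfl⟩⟩ := by
    rintro _ x' rfl
    rfl
  exact key (π x) (g.1⁻¹ x) (g⁻¹.2 x)

/-- The representation of the deck transformation group on `H^0(X, π^* F)`. -/
def pullbackRep (π : C(X, Y)) (F : TopCat.Sheaf (ModuleCat.{u} R) Y) :
    Representation R (deck π) (pullbackSections π F) where
  toFun g := (germAction π F g).restrict fun s hs => by
    show Continuous (toEtale (germAction π F g s))
    rw [show toEtale (germAction π F g s) = toEtale s ∘ ⇑(g.1⁻¹) from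
      funext (toEtale_germAction π F g s)]
    exact Continuous.comp hs (g.1⁻¹).continuous
  map_one' := rfl
  map_mul' _ _ := rfl

/-- The map on families of germs induced by a morphism of sheaves. -/
def germMap (π : X → Y) {F F' : TopCat.Sheaf (ModuleCat.{u} R) Y} (f : F ⟶ F') :
    GermFamily π F →ₗ[R] GermFamily π F' where
  toFun s y x := ((TopCat.Presheaf.stalkFunctor _ y).map f.hom).hom (s y x)
  map_add' _ _ := by
    ext
    exact map_add _ _ _
  map_smul' _ _ := by
    ext
    exact map_smul _ _ _

theorem germMap_mem (π : C(X, Y)) {F F' : TopCat.Sheaf (ModuleCat.{u} R) Y} (f : F ⟶ F')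
    (s : GermFamily π F) (hs : s ∈ pullbackSections π F) :
    germMap π f s ∈ pullbackSections π F' :=
  (continuous_toEtale_iff π.continuous _).2 fun x => by
    obtain ⟨U, hU, t, ht⟩ := (continuous_toEtale_iff π.continuous _).1 hs x
    refine ⟨U, hU, f.hom.app (op U) t, ?_⟩
    filter_upwards [ht] with x' ⟨h1, e1⟩
    refine ⟨h1, ?_⟩
    show ((TopCat.Presheaf.stalkFunctor _ (π x')).map f.hom).hom (s (π x') ⟨x', rfl⟩) = _
    rw [e1]
    exact TopCat.Presheaf.stalkFunctor_map_germ_apply U (π x') h1 f.hom t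

/-- The functor `F ↦ H^0(X, π^* F)` from sheaves of `R`-modules on `Y` to representations of the
deck transformation group of `π : X → Y`. -/
def pullbackSectionsFunctor (R : Type u) [CommRing R] (π : C(X, Y)) :
    TopCat.Sheaf (ModuleCat.{u} R) Y ⥤ Rep.{u} R (deck π) where
  obj F := Rep.of (pullbackRep π F)
  map f := Rep.ofHom ⟨(germMap π f).restrict (germMap_mem π f), fun _ => rfl⟩
  map_id F := by
    ext s y x
    show ((TopCat.Presheaf.stalkFunctor _ y).map (𝟙 F.obj)).hom (s.1 y x) = s.1 y x
    rw [CategoryTheory.Functor.map_id]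
    rfl
  map_comp f f' := by
    ext s y x
    show ((TopCat.Presheaf.stalkFunctor _ y).map (f.hom ≫ f'.hom)).hom (s.1 y x) = _
    rw [CategoryTheory.Functor.map_comp]
    rfl

instance (π : C(X, Y)) : (pullbackSectionsFunctor R π).Additive where
  map_add {F F' f f'} := by
    ext s
    refine Subtype.ext (funext fun y => funext fun x => ?_)
    show ((TopCat.Presheaf.stalkFunctor _ y).map (f.hom + f'.hom)).hom (s.1 y x) = _
    rw [CategoryTheory.Functor.map_add]
    rfl

/-- The functor `H_q^0(Y, C, F) = H_q^0(Γ, Σ, H^0(X, π^* F))`, where `π : X → Y` is the universal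
covering, `ρ : X → C` is the map through which it factors, `Γ` is the fundamental group of `Y` and
`Σ` is that of `C`. -/
def sheafH0 (R : Type u) [CommRing R] {C : Type u} (π : C(X, Y)) (ρ : X → C) (q : ℕ) :
    TopCat.Sheaf (ModuleCat.{u} R) Y ⥤ ModuleCat.{u} R :=
  pullbackSectionsFunctor R π ⋙ groupH0 R (deckOver π ρ) q

instance {C : Type u} (π : C(X, Y)) (ρ : X → C) (q : ℕ) : (sheafH0 R π ρ q).Additive := by
  unfold sheafH0
  infer_instance

/-- The global sections functor `H^0(Y, ·)`. -/
def globalSections (R : Type u) [CommRing R] (Y : TopCat.{u}) :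
    TopCat.Sheaf (ModuleCat.{u} R) Y ⥤ ModuleCat.{u} R :=
  TopCat.Sheaf.forget (ModuleCat.{u} R) Y ⋙ (evaluation _ _).obj (op ⊤)

instance : (globalSections R Y).Additive where
  map_add := rfl

/-- Acyclicity of a sheaf for an additive functor `T`: `R^p T (F) = 0` for `p ≥ 1`. -/
def IsAcyclicFor (T : TopCat.Sheaf (ModuleCat.{u} R) Y ⥤ ModuleCat.{u} R) [T.Additive]
    (F : TopCat.Sheaf (ModuleCat.{u} R) Y) : Prop :=
  ∀ p : ℕ, 1 ≤ p → Limits.IsZero ((T.rightDerived p).obj F)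

/-- The endomorphism of the stalk at `y` induced by an endomorphism of a sheaf. -/
def stalkEnd {F : TopCat.Sheaf (ModuleCat.{u} R) Y} (h : F ⟶ F) (y : Y) :
    F.presheaf.stalk y →ₗ[R] F.presheaf.stalk y :=
  ((TopCat.Presheaf.stalkFunctor _ y).map h.hom).hom

/-- A fine sheaf: for every locally finite open cover `(U_i)` there are endomorphisms `h_i` of
the sheaf, the closed support of `h_i` being contained in `U_i`, whose sum is the identity. -/
def IsFine (F : TopCat.Sheaf (ModuleCat.{u} R) Y) : Prop :=
  ∀ (ι : Type u) (U : ι → Opens Y), (⨆ i, U i) = ⊤ → LocallyFinite (fun i => (U i : Set Y)) →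
    ∃ h : ι → (F ⟶ F), (∀ i, closure {y | stalkEnd (h i) y ≠ 0} ⊆ (U i : Set Y)) ∧
      ∀ (y : Y) (a : F.presheaf.stalk y), ∑ᶠ i, stalkEnd (h i) y a = a

end Sheaves

end

end HigherOrder

/-! Write `A = R[Γ]` and `M(F) = H^0(X, π^* F)`. A homomorphism `A / J → V` is determined by the
image of `1`, so `H_q^0(Y, C, F)` is the set of elements of `M(F)` that are killed by `J_q`
(`sheafH0Iso`). Since `A I_Σ ⊂ I`, the ideal `J_1` is `I`. What it kills are the invariants, and
these descend to sections of `F` over `Y` (`globalSectionsIso`). This gives (a) at the level of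
functors, hence for all derived functors.

For (b), the main point is that an injective sheaf `F` gives an injective `A`-module `M(F)`, in the
form of Baer's condition (`isBaer_of_injective`). A homomorphism `φ : K → M(F)` on a left ideal is
encoded as a morphism from a presheaf of equivariant `K`-valued functions on `X` to `F`. Injectivity
extends that morphism to all `A`-valued functions, and evaluating the extension at local
trivializations of the covering gives the element of `M(F)` that represents `φ`.

Let `0 → F → E → Q → 0` be exact with `E` injective and `F` acyclic for `H^0`. Then `H_1^0(E) →
H_1^0(Q)` is onto. Baer's condition and the freeness of `J_k / J_{k+1}` propagate surjectivity from
`J_1` to `J_q` by induction (`exists_annihilated_idealJ_of_isBaer`): `Γ` acts trivially on `J_k /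
J_{k+1}`, so a map from it to invariants of `M(Q)` can be lifted to invariants of `M(E)` on a basis.
As `Q` is acyclic for `H^0` again, dimension shifting (`acyclic_of_class`) makes `F` acyclic for
`H_q^0`.

For (c), flasque sheaves are acyclic for `H^0` by the usual Zorn argument, and fine sheaves by a
partition of unity argument inside the Godement sheaf. By (b) they are acyclic for `H_q^0`, and
acyclic resolutions compute derived functors (`rightDerived_iso_homology`). -/

namespace HigherOrder

noncomputable section

/-! ### Injective resolutions and dimension shifting along injectives. -/

section Homological

open Limits

variable {𝒞 : Type*} [Category* 𝒞] [Abelian 𝒞]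

/-- For a short exact sequence `0 ⟶ A ⟶ B ⟶ C ⟶ 0` and a monomorphism `B ⟶ E`, there is a short exact
sequence `0 ⟶ C ⟶ E / A ⟶ E / B ⟶ 0`. -/
theorem exists_shortExact_cokernel {S : ShortComplex 𝒞} (hS : S.ShortExact) {E : 𝒞} (i : S.X₂ ⟶ E)
    [Mono i] : ∃ (j : S.X₃ ⟶ cokernel (S.f ≫ i)) (k : cokernel (S.f ≫ i) ⟶ cokernel i)
      (w : j ≫ k = 0), (ShortComplex.mk j k w).ShortExact ∧
        S.g ≫ j = i ≫ cokernel.π (S.f ≫ i) ∧ cokernel.π (S.f ≫ i) ≫ k = cokernel.π i := by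
  have := hS.mono_f
  have := hS.epi_g
  let j : S.X₃ ⟶ cokernel (S.f ≫ i) := hS.exact.desc (i ≫ cokernel.π (S.f ≫ i))
    (by rw [← Category.assoc, cokernel.condition])
  have hj : S.g ≫ j = i ≫ cokernel.π (S.f ≫ i) := hS.exact.g_desc _ _
  let k : cokernel (S.f ≫ i) ⟶ cokernel i := cokernel.desc _ (cokernel.π i) (by simp)
  have hk : cokernel.π (S.f ≫ i) ≫ k = cokernel.π i := cokernel.π_desc _ _ _
  have w : j ≫ k = 0 := by
    rw [← cancel_epi S.g, ← Category.assoc, hj, Category.assoc, hk, cokernel.condition, comp_zero]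
  refine ⟨j, k, w, ?_, hj, hk⟩
  -- An element of `B` whose image in `E` comes from `A` already comes from `A` in `B`, because `i`
  -- is mono.
  have hmono : Mono j := by
    refine Preadditive.mono_of_cancel_zero _ fun {P} x hx => ?_
    obtain ⟨P', π, _, b, hb⟩ := surjective_up_to_refinements_of_epi S.g x
    have hex : (ShortComplex.mk (S.f ≫ i) (cokernel.π (S.f ≫ i)) (cokernel.condition _)).Exact :=
      ShortComplex.exact_cokernel _
    obtain ⟨P'', π', _, a, ha⟩ := hex.exact_up_to_refinements (b ≫ i) (by
      show (b ≫ i) ≫ cokernel.π (S.f ≫ i) = 0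
      rw [Category.assoc, ← hj, ← Category.assoc, ← hb, Category.assoc, hx, comp_zero])
    have ha' : π' ≫ b = a ≫ S.f := by
      rw [← cancel_mono i]
      simpa using ha
    rw [← cancel_epi π, ← cancel_epi π', hb, ← Category.assoc, ha']
    simp
  have hepi : Epi k := epi_of_epi_fac hk
  refine ShortComplex.ShortExact.mk' ?_ hmono hepi
  refine ShortComplex.exact_of_g_is_cokernel _ (CokernelCofork.IsColimit.ofπ' _ _ fun {T} t ht => ?_)
  refine ⟨cokernel.desc _ (cokernel.π _ ≫ t) ?_, ?_⟩
  · rw [← Category.assoc, ← hj, Category.assoc]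
    rw [show j ≫ t = 0 from ht, comp_zero]
  · rw [← cancel_epi (cokernel.π (S.f ≫ i))]
    show _ ≫ k ≫ _ = _
    rw [← Category.assoc, hk, cokernel.π_desc]

/-- A monomorphism `f` into an exact cochain complex that is exact at `K.X 0` as well gives a quasi-isomorphism. -/
theorem quasiIso_fromSingle₀ {F : 𝒞} (K : CochainComplex 𝒞 ℕ) (f : F ⟶ K.X 0)
    (w : f ≫ K.d 0 1 = 0) (hf : Mono f) (h₀ : (ShortComplex.mk f (K.d 0 1) w).Exact)
    (h : ∀ n, K.ExactAt (n + 1)) :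
    QuasiIso ((CochainComplex.fromSingle₀Equiv K F).symm ⟨f, w⟩) := ⟨fun n => by
  cases n with
  | zero =>
    rw [CochainComplex.quasiIsoAt₀_iff, ShortComplex.quasiIso_iff_of_zeros]
    · refine (ShortComplex.exact_and_mono_f_iff_of_iso ?_).2 ⟨h₀, hf⟩
      refine ShortComplex.isoMk (Iso.refl _) (Iso.refl _) (Iso.refl _) ?_ ?_
      · exact (Category.id_comp _).trans ((CochainComplex.fromSingle₀Equiv_symm_apply_f_zero
          f w).symm.trans (Category.comp_id _).symm)
      · exact (Category.id_comp _).trans (Category.comp_id _).symm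
    · rfl
    · rfl
    · exact K.shape 0 0 (by simp)
  | succ n =>
    rw [quasiIsoAt_iff_exactAt]
    · exact h n
    · exact CochainComplex.exactAt_succ_single_obj _ _⟩

/-- The exactness properties of a resolution. -/
theorem exists_of_quasiIso_single₀ {F : 𝒞} {K : CochainComplex 𝒞 ℕ}
    (ε : (CochainComplex.single₀ 𝒞).obj F ⟶ K) (hε : QuasiIso ε) :
    ∃ (f : F ⟶ K.X 0) (w : f ≫ K.d 0 1 = 0), Mono f ∧ (ShortComplex.mk f (K.d 0 1) w).Exact ∧
      ∀ n, K.ExactAt (n + 1) := by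
  obtain ⟨⟨f, w⟩, rfl⟩ := (CochainComplex.fromSingle₀Equiv K F).symm.surjective ε
  have h₀ := hε.quasiIsoAt 0
  rw [CochainComplex.quasiIsoAt₀_iff, ShortComplex.quasiIso_iff_of_zeros] at h₀
  · have h := (ShortComplex.exact_and_mono_f_iff_of_iso (S₂ := ShortComplex.mk f (K.d 0 1) w) <| by
      refine ShortComplex.isoMk (Iso.refl _) (Iso.refl _) (Iso.refl _) ?_ ?_
      · exact (Category.id_comp _).trans ((CochainComplex.fromSingle₀Equiv_symm_apply_f_zero
          f w).symm.trans (Category.comp_id _).symm)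
      · exact (Category.id_comp _).trans (Category.comp_id _).symm).1 h₀
    refine ⟨f, w, h.2, h.1, fun n => ?_⟩
    exact (quasiIsoAt_iff_exactAt _ (n + 1) (CochainComplex.exactAt_succ_single_obj _ _)).1
      (hε.quasiIsoAt (n + 1))
  · rfl
  · rfl
  · exact K.shape 0 0 (by simp)

/-- A cochain complex prolonged to the left by a morphism `p ≫ e` with `p` epi, `e` mono. -/
theorem exactAt_augment {B Q : 𝒞} (J : CochainComplex 𝒞 ℕ) (p : B ⟶ Q) (e : Q ⟶ J.X 0)
    (w : e ≫ J.d 0 1 = 0) (w' : (p ≫ e) ≫ J.d 0 1 = 0) (hp : Epi p)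
    (h₀ : (ShortComplex.mk e (J.d 0 1) w).Exact) (h : ∀ n, J.ExactAt (n + 1)) (n : ℕ) :
    (CochainComplex.augment J (p ≫ e) w').ExactAt (n + 1) := by
  rw [HomologicalComplex.exactAt_iff' _ n (n + 1) (n + 2) (by simp) (by simp)]
  cases n with
  | zero =>
    show (ShortComplex.mk (p ≫ e) (J.d 0 1) w').Exact
    rw [ShortComplex.exact_iff_exact_up_to_refinements] at h₀ ⊢
    intro P x hx
    obtain ⟨P', π, hπ, y, hy⟩ := h₀ x hx
    obtain ⟨P'', π', hπ', z, hz⟩ := surjective_up_to_refinements_of_epi p y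
    refine ⟨P'', π' ≫ π, epi_comp _ _, z, ?_⟩
    show (π' ≫ π) ≫ x = z ≫ p ≫ e
    rw [← Category.assoc z, ← hz, Category.assoc, hy, Category.assoc]
  | succ n =>
    have := h n
    rw [HomologicalComplex.exactAt_iff' _ n (n + 1) (n + 2) (by simp) (by simp)] at this
    exact this

theorem exact_comp_mono {S : ShortComplex 𝒞} (hS : S.Exact) {J : 𝒞} (e : S.X₃ ⟶ J) [Mono e] :
    (ShortComplex.mk S.f (S.g ≫ e) (by rw [← Category.assoc, S.zero, zero_comp])).Exact := by
  rw [ShortComplex.exact_iff_exact_up_to_refinements] at hS ⊢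
  intro P x hx
  refine hS x ?_
  rw [← cancel_mono e, zero_comp, Category.assoc]
  exact hx

/-- Splicing an injective resolution of `S.X₃` with a short exact sequence `S` with `S.X₂` injective
yields an injective resolution of `S.X₁`. -/
theorem exists_injectiveResolution_splice {S : ShortComplex 𝒞} (hS : S.ShortExact) [Injective S.X₂]
    (J : CochainComplex 𝒞 ℕ) (hJ : ∀ n, Injective (J.X n)) (e : S.X₃ ⟶ J.X 0) (he : Mono e)
    (w : e ≫ J.d 0 1 = 0) (h₀ : (ShortComplex.mk e (J.d 0 1) w).Exact)
    (h : ∀ n, J.ExactAt (n + 1)) (w' : (S.g ≫ e) ≫ J.d 0 1 = 0) :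
    ∃ I : InjectiveResolution S.X₁, I.cocomplex = CochainComplex.augment J (S.g ≫ e) w' := by
  have wf : S.f ≫ S.g ≫ e = 0 := by rw [← Category.assoc, S.zero, zero_comp]
  have := quasiIso_fromSingle₀ (CochainComplex.augment J (S.g ≫ e) w') S.f wf hS.mono_f
    (exact_comp_mono hS.exact e) (exactAt_augment J S.g e w w' hS.epi_g h₀ h)
  exact ⟨{
    cocomplex := CochainComplex.augment J (S.g ≫ e) w'
    injective := fun n => by
      cases n with
      | zero => exact (inferInstance : Injective S.X₂)
      | succ n => exact hJ n
    ι := (CochainComplex.fromSingle₀Equiv _ _).symm ⟨S.f, wf⟩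
    quasiIso := this }, rfl⟩

variable {𝒟 : Type*} [Category* 𝒟] [Abelian 𝒟]

/-- The homology of `T K` at `n + 1` in terms of the differentials of `K`. -/
def mapHomologyIso (T : 𝒞 ⥤ 𝒟) [T.Additive] (K : CochainComplex 𝒞 ℕ) (n : ℕ) :
    ((T.mapHomologicalComplex (ComplexShape.up ℕ)).obj K).homology (n + 1) ≅
      (ShortComplex.mk (T.map (K.d n (n + 1))) (T.map (K.d (n + 1) (n + 2)))
        (by rw [← T.map_comp, K.d_comp_d, T.map_zero])).homology :=
  ShortComplex.homologyMapIso
    (HomologicalComplex.isoSc' _ n (n + 1) (n + 2) (by simp) (by simp))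

variable [EnoughInjectives 𝒞] (T : 𝒞 ⥤ 𝒟) [T.Additive]

/-- The homology of `0 ⟶ TA ⟶ TB ⟶ TC` type complexes `X ⟶ Y ⟶ Z` where the kernel of the
second map is known. -/
def homologyIsoCokernel {S : ShortComplex 𝒟} {Z : 𝒟} (i : Z ⟶ S.X₂) (_ : Mono i) (wi : i ≫ S.g = 0)
    (hi : (ShortComplex.mk i S.g wi).Exact) (f : S.X₁ ⟶ Z) (hf : f ≫ i = S.f) :
    S.homology ≅ cokernel f :=
  let h : S.LeftHomologyData :=
    { K := Z, H := cokernel f, i := i, π := cokernel.π f, wi := wi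
      hi := hi.fIsKernel
      wπ := by
        have : (hi.fIsKernel).lift (KernelFork.ofι S.f S.zero) = f := by
          rw [← cancel_mono i, hf]
          exact hi.fIsKernel.fac _ WalkingParallelPair.zero
        rw [this, cokernel.condition]
      hπ := by
        have : (hi.fIsKernel).lift (KernelFork.ofι S.f S.zero) = f := by
          rw [← cancel_mono i, hf]
          exact hi.fIsKernel.fac _ WalkingParallelPair.zero
        refine CokernelCofork.IsColimit.ofπ' _ _ fun {A} k hk => ?_
        rw [this] at hk
        exact ⟨cokernel.desc _ k hk, cokernel.π_desc _ _ _⟩ }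
  h.homologyIso

/-- Dimension shifting along an embedding into an injective object. -/
theorem rightDerived_shift_of_injective {S : ShortComplex 𝒞} (hS : S.ShortExact)
    [Injective S.X₂] (p : ℕ) : Nonempty ((T.rightDerived (p + 2)).obj S.X₁ ≅
      (T.rightDerived (p + 1)).obj S.X₃) := by
  let J := injectiveResolution S.X₃
  obtain ⟨e, w, he, h₀, h⟩ := exists_of_quasiIso_single₀ J.ι J.quasiIso
  obtain ⟨I, hI⟩ := exists_injectiveResolution_splice hS J.cocomplex J.injective e he w h₀ h
    (by rw [Category.assoc, w, comp_zero])
  refine ⟨I.isoRightDerivedObj T (p + 2) ≪≫ ?_ ≪≫ (J.isoRightDerivedObj T (p + 1)).symm⟩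
  refine mapHomologyIso T I.cocomplex (p + 1) ≪≫ ?_ ≪≫ (mapHomologyIso T J.cocomplex p).symm
  -- Beyond its first term the augmented complex is `J` shifted by one, so both short complexes are
  -- the same by definition.
  rw [hI]
  exact Iso.refl _

/-- In the spliced resolution `S.X₂` sits in degree 0. By left exactness the cocycles in degree 1
are `T S.X₃`, and the coboundaries are the image of `T S.X₂`. -/
theorem rightDerived_one_iso_of_injective [PreservesFiniteLimits T] {S : ShortComplex 𝒞}
    (hS : S.ShortExact) [Injective S.X₂] :
    Nonempty ((T.rightDerived 1).obj S.X₁ ≅ cokernel (T.map S.g)) := by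
  let J := injectiveResolution S.X₃
  obtain ⟨e, w, he, h₀, h⟩ := exists_of_quasiIso_single₀ J.ι J.quasiIso
  obtain ⟨I, hI⟩ := exists_injectiveResolution_splice hS J.cocomplex J.injective e he w h₀ h
    (by rw [Category.assoc, w, comp_zero])
  refine ⟨I.isoRightDerivedObj T 1 ≪≫ mapHomologyIso T I.cocomplex 0 ≪≫ ?_⟩
  rw [hI]
  have : Mono (T.map e) := T.map_mono e
  let J' := CochainComplex.augment J.cocomplex (S.g ≫ e) (by rw [Category.assoc, w, comp_zero])
  refine homologyIsoCokernel (S := ShortComplex.mk (T.map (J'.d 0 1)) (T.map (J'.d 1 2))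
      (by rw [← T.map_comp, J'.d_comp_d, T.map_zero])) (Z := T.obj S.X₃) (T.map e) this
    (show T.map e ≫ T.map (J.cocomplex.d 0 1) = 0 by rw [← T.map_comp, w, Functor.map_zero]) ?_
    (T.map S.g) (T.map_comp _ _).symm
  exact h₀.map_of_mono_of_preservesKernel T he inferInstance

end Homological

/-! ### Acyclic objects, dimension shifting and acyclic resolutions. -/

section Acyclic

open Limits

variable {𝒞 : Type*} [Category* 𝒞] {R : Type u} [CommRing R] (T : 𝒞 ⥤ ModuleCat.{u} R)

/-- The three conditions are what the map induced by `b` needs to be well defined, surjective and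
injective on cokernels. No map `A ⟶ C` has to be given. -/
theorem nonempty_cokernel_iso {A B C D : ModuleCat.{u} R} (f : A ⟶ B) (g : C ⟶ D) (b : B ⟶ D)
    (h : ∀ a, ∃ c, g c = b (f a)) (hs : ∀ d, ∃ x c, d = b x + g c)
    (hi : ∀ x c, b x = g c → ∃ a, f a = x) : Nonempty (cokernel f ≅ cokernel g) := by
  let φ : (B ⧸ LinearMap.range f.hom) →ₗ[R] (D ⧸ LinearMap.range g.hom) :=
    Submodule.mapQ _ _ b.hom (by
      rintro _ ⟨a, rfl⟩
      exact h a)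
  refine ⟨ModuleCat.cokernelIsoRangeQuotient f ≪≫ (LinearEquiv.ofBijective φ ⟨?_, ?_⟩).toModuleIso ≪≫
    (ModuleCat.cokernelIsoRangeQuotient g).symm⟩
  · rw [injective_iff_map_eq_zero]
    intro x hx
    obtain ⟨x, rfl⟩ := Submodule.Quotient.mk_surjective _ x
    obtain ⟨c, hc⟩ := (Submodule.Quotient.mk_eq_zero _).1 hx
    exact (Submodule.Quotient.mk_eq_zero _).2 (hi x c hc.symm)
  · intro d
    obtain ⟨d, rfl⟩ := Submodule.Quotient.mk_surjective _ d
    obtain ⟨x, c, rfl⟩ := hs d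
    refine ⟨Submodule.Quotient.mk x, (Submodule.Quotient.eq _).2 ⟨-c, ?_⟩⟩
    show g (-c) = b x - (b x + g c)
    rw [map_neg]
    abel

theorem isZero_cokernel_iff {A B : ModuleCat.{u} R} (f : A ⟶ B) :
    IsZero (cokernel f) ↔ Function.Surjective f := by
  rw [← ModuleCat.epi_iff_surjective]
  exact ⟨fun h => Preadditive.epi_of_isZero_cokernel f h, fun h => isZero_cokernel_of_epi f⟩

theorem map_comp_apply_eq {A B B' C : 𝒞} {f : A ⟶ B} {g : B ⟶ C} {f' : A ⟶ B'} {g' : B' ⟶ C}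
    (h : f ≫ g = f' ≫ g') (a : T.obj A) : T.map g (T.map f a) = T.map g' (T.map f' a) := by
  rw [← ModuleCat.comp_apply, ← ModuleCat.comp_apply, ← T.map_comp, ← T.map_comp, h]

theorem map_comp_apply_eq' {A B C : 𝒞} {f : A ⟶ B} {g : B ⟶ C} {k : A ⟶ C}
    (h : f ≫ g = k) (a : T.obj A) : T.map g (T.map f a) = T.map k a := by
  rw [← ModuleCat.comp_apply, ← T.map_comp, h]

variable [Abelian 𝒞]

theorem map_f_injective [PreservesFiniteLimits T] {S : ShortComplex 𝒞} (hS : S.ShortExact) :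
    Function.Injective (T.map S.f) := by
  have := hS.mono_f
  exact (ModuleCat.mono_iff_injective _).1 (T.map_mono S.f)

theorem exists_of_map_g_eq_zero [PreservesFiniteLimits T] [T.PreservesZeroMorphisms]
    {S : ShortComplex 𝒞} (hS : S.ShortExact) (b : T.obj S.X₂) (hb : T.map S.g b = 0) :
    ∃ a, T.map S.f a = b :=
  (ShortComplex.moduleCat_exact_iff _).1
    (hS.exact.map_of_mono_of_preservesKernel T hS.mono_f inferInstance) b hb

theorem shortExact_cokernel {A B : 𝒞} (f : A ⟶ B) [Mono f] :
    (ShortComplex.mk f (cokernel.π f) (cokernel.condition f)).ShortExact :=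
  ShortComplex.ShortExact.mk' (ShortComplex.exact_cokernel _) inferInstance inferInstance

/-- The factorization of a differential of an exact complex through the cokernel of the
previous one. -/
theorem exists_mono_cokernel_desc {F : 𝒞} (K : CochainComplex 𝒞 ℕ) (m : ℕ) (f : F ⟶ K.X m)
    (w : f ≫ K.d m (m + 1) = 0) (h₀ : (ShortComplex.mk f (K.d m (m + 1)) w).Exact)
    (h : K.ExactAt (m + 1)) :
    ∃ (e : cokernel f ⟶ K.X (m + 1)) (w' : e ≫ K.d (m + 1) (m + 2) = 0), Mono e ∧
      (ShortComplex.mk e (K.d (m + 1) (m + 2)) w').Exact ∧ cokernel.π f ≫ e = K.d m (m + 1) := by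
  rw [HomologicalComplex.exactAt_iff' _ m (m + 1) (m + 2) (by simp) (by simp)] at h
  replace h : (ShortComplex.mk _ _ (K.d_comp_d m (m + 1) (m + 2))).Exact := h
  refine ⟨cokernel.desc f _ w, ?_, ?_, ?_, cokernel.π_desc _ _ _⟩
  · rw [← cancel_epi (cokernel.π f), ← Category.assoc, cokernel.π_desc, K.d_comp_d, comp_zero]
  · exact h₀.mono_cokernelDesc
  · rw [ShortComplex.exact_iff_exact_up_to_refinements] at h ⊢
    intro P x hx
    obtain ⟨P', π, hπ, y, hy⟩ := h x hx
    refine ⟨P', π, hπ, y ≫ cokernel.π f, ?_⟩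
    show π ≫ x = (y ≫ cokernel.π f) ≫ cokernel.desc f _ w
    exact (hy.trans (congrArg (y ≫ ·) (cokernel.π_desc f _ w).symm)).trans
      (Category.assoc _ _ _).symm

variable [EnoughInjectives 𝒞] [T.Additive]

/-- The vanishing of the higher derived functors. -/
def Acyclic (A : 𝒞) : Prop :=
  ∀ p : ℕ, IsZero ((T.rightDerived (p + 1)).obj A)

theorem acyclic_of_injective {S : ShortComplex 𝒞} (hS : S.ShortExact) [Injective S.X₂]
    (h : Acyclic T S.X₁) : Acyclic T S.X₃ := fun p =>
  (h (p + 1)).of_iso (rightDerived_shift_of_injective T hS p).some.symm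

variable [PreservesFiniteLimits T]

/-- Embed `S.X₂` in an injective `E`. The image of `c` in `T (E / S.X₁)` lifts to `T E` because
`R¹T` vanishes at `S.X₁`. The lift dies in `T (E / S.X₂)`, so it comes from `T S.X₂`. -/
theorem map_g_surjective_of_isZero {S : ShortComplex 𝒞} (hS : S.ShortExact)
    (h : IsZero ((T.rightDerived 1).obj S.X₁)) : Function.Surjective (T.map S.g) := by
  intro c
  obtain ⟨j, k, w, hjk, hj, hk⟩ := exists_shortExact_cokernel hS (Injective.ι S.X₂)
  have := hS.mono_f
  have hE : (ShortComplex.mk (S.f ≫ Injective.ι S.X₂) (cokernel.π _) (cokernel.condition _)).ShortExact :=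
    ShortComplex.ShortExact.mk' (ShortComplex.exact_cokernel _) inferInstance inferInstance
  have hE' : (ShortComplex.mk (Injective.ι S.X₂) (cokernel.π _) (cokernel.condition _)).ShortExact :=
    ShortComplex.ShortExact.mk' (ShortComplex.exact_cokernel _) inferInstance inferInstance
  have : Injective (Injective.under S.X₂) := inferInstance
  obtain ⟨iso⟩ := rightDerived_one_iso_of_injective T hE
  obtain ⟨e, he⟩ := (isZero_cokernel_iff _).1 (h.of_iso iso.symm) (T.map j c)
  obtain ⟨b, hb⟩ := exists_of_map_g_eq_zero T hE' e (by
    show T.map (cokernel.π _) e = 0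
    rw [← map_comp_apply_eq' T hk, he, map_comp_apply_eq' T w]
    simp)
  refine ⟨b, map_f_injective T hjk ?_⟩
  show T.map j _ = T.map j c
  rw [map_comp_apply_eq T hj, hb]
  exact he

/-- `H^1` of the first term of a short exact sequence with acyclic middle term. -/
theorem rightDerived_one_iso {S : ShortComplex 𝒞} (hS : S.ShortExact)
    (h : IsZero ((T.rightDerived 1).obj S.X₂)) :
    Nonempty ((T.rightDerived 1).obj S.X₁ ≅ cokernel (T.map S.g)) := by
  have := hS.mono_f
  obtain ⟨j, k, w, hjk, hj, hk⟩ := exists_shortExact_cokernel hS (Injective.ι S.X₂)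
  have hE := shortExact_cokernel (S.f ≫ Injective.ι S.X₂)
  have hE' := shortExact_cokernel (Injective.ι S.X₂)
  have : Injective (Injective.under S.X₂) := inferInstance
  obtain ⟨iso⟩ := rightDerived_one_iso_of_injective T hE
  obtain ⟨iso'⟩ := nonempty_cokernel_iso (T.map S.g) (T.map (cokernel.π (S.f ≫ Injective.ι S.X₂)))
    (T.map j) (fun b => ⟨T.map (Injective.ι _) b, map_comp_apply_eq T hj.symm b⟩) (fun q => by
      -- Acyclicity of `S.X₂` lifts the image of `q` in `T (E / S.X₂)` to `T E`; subtracting the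
      -- lift leaves an element of `T S.X₃`.
      obtain ⟨e, he⟩ := map_g_surjective_of_isZero T hE' h (T.map k q)
      obtain ⟨c, hc⟩ := exists_of_map_g_eq_zero T hjk
        (q - T.map (cokernel.π (S.f ≫ Injective.ι S.X₂)) e) (by
          show T.map k _ = 0
          rw [map_sub, map_comp_apply_eq' T hk, sub_eq_zero]
          exact he.symm)
      exact ⟨c, e, sub_eq_iff_eq_add.1 hc.symm⟩) (fun c e he => by
      obtain ⟨b, hb⟩ := exists_of_map_g_eq_zero T hE' e (by
        show T.map (cokernel.π _) e = 0
        rw [← map_comp_apply_eq' T hk, ← he, map_comp_apply_eq' T w]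
        simp)
      refine ⟨b, map_f_injective T hjk ?_⟩
      show T.map j _ = T.map j c
      rw [map_comp_apply_eq T hj, he]
      exact congrArg (T.map _) hb)
  exact ⟨iso ≪≫ iso'.symm⟩

/-- The three comparison statements for derived functors in degree `p + 1`. -/
theorem rightDerived_iso_aux (p : ℕ) :
    (∀ S : ShortComplex 𝒞, S.ShortExact → Acyclic T S.X₃ → Function.Surjective (T.map S.g) →
      Nonempty ((T.rightDerived (p + 1)).obj S.X₁ ≅ (T.rightDerived (p + 1)).obj S.X₂)) ∧
    (∀ S : ShortComplex 𝒞, S.ShortExact → Acyclic T S.X₁ →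
      Nonempty ((T.rightDerived (p + 1)).obj S.X₂ ≅ (T.rightDerived (p + 1)).obj S.X₃)) ∧
    (∀ S : ShortComplex 𝒞, S.ShortExact → Acyclic T S.X₂ →
      Nonempty ((T.rightDerived (p + 2)).obj S.X₁ ≅ (T.rightDerived (p + 1)).obj S.X₃)) := by
  -- All three statements are applied to `0 → S.X₃ → E / S.X₁ → E / S.X₂ → 0` with `E` injective. In
  -- a fixed degree the third follows from the first. One degree up, the first follows from the
  -- second and the second from the third. This replaces the long exact sequence.
  have hZ : ∀ p, (∀ S : ShortComplex 𝒞, S.ShortExact → Acyclic T S.X₃ →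
      Function.Surjective (T.map S.g) →
      Nonempty ((T.rightDerived (p + 1)).obj S.X₁ ≅ (T.rightDerived (p + 1)).obj S.X₂)) →
    (∀ S : ShortComplex 𝒞, S.ShortExact → Acyclic T S.X₂ →
      Nonempty ((T.rightDerived (p + 2)).obj S.X₁ ≅ (T.rightDerived (p + 1)).obj S.X₃)) := by
    intro p hX S hS h
    have := hS.mono_f
    obtain ⟨j, k, w, hjk, hj, hk⟩ := exists_shortExact_cokernel hS (Injective.ι S.X₂)
    have hE := shortExact_cokernel (S.f ≫ Injective.ι S.X₂)
    have hE' := shortExact_cokernel (Injective.ι S.X₂)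
    have : Injective (Injective.under S.X₂) := inferInstance
    have hW : Acyclic T (cokernel (Injective.ι S.X₂)) := acyclic_of_injective T hE' h
    obtain ⟨a⟩ := rightDerived_shift_of_injective T hE p
    obtain ⟨b⟩ := hX _ hjk hW (fun x => by
      obtain ⟨e, he⟩ := map_g_surjective_of_isZero T hE' (h 0) x
      exact ⟨T.map (cokernel.π _) e, (map_comp_apply_eq' T hk e).trans he⟩)
    exact ⟨a ≪≫ b.symm⟩
  induction p with
  | zero =>
    have hX : ∀ S : ShortComplex 𝒞, S.ShortExact → Acyclic T S.X₃ →
        Function.Surjective (T.map S.g) →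
        Nonempty ((T.rightDerived 1).obj S.X₁ ≅ (T.rightDerived 1).obj S.X₂) := by
      intro S hS h hs
      have := hS.mono_f
      obtain ⟨j, k, w, hjk, hj, hk⟩ := exists_shortExact_cokernel hS (Injective.ι S.X₂)
      have hE := shortExact_cokernel (S.f ≫ Injective.ι S.X₂)
      have hE' := shortExact_cokernel (Injective.ι S.X₂)
      have : Injective (Injective.under S.X₂) := inferInstance
      obtain ⟨a⟩ := rightDerived_one_iso_of_injective T hE
      obtain ⟨b⟩ := rightDerived_one_iso_of_injective T hE'
      obtain ⟨c⟩ := nonempty_cokernel_iso (T.map (cokernel.π (S.f ≫ Injective.ι S.X₂)))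
        (T.map (cokernel.π (Injective.ι S.X₂))) (T.map k)
        (fun e => ⟨e, (map_comp_apply_eq' T hk e).symm⟩) (fun d => by
          obtain ⟨x, hx⟩ := map_g_surjective_of_isZero T hjk (h 0) d
          exact ⟨x, 0, by rw [map_zero, add_zero]; exact hx.symm⟩) (fun x e hx => by
          obtain ⟨w, hw⟩ := exists_of_map_g_eq_zero T hjk
            (x - T.map (cokernel.π (S.f ≫ Injective.ι S.X₂)) e) (by
              show T.map k _ = 0
              rw [map_sub, map_comp_apply_eq' T hk, sub_eq_zero]
              exact hx)
          obtain ⟨m, rfl⟩ := hs w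
          refine ⟨T.map (Injective.ι _) m + e, ?_⟩
          rw [map_add, ← map_comp_apply_eq T hj]
          exact sub_eq_iff_eq_add.1 hw.symm ▸ rfl)
      exact ⟨a ≪≫ c ≪≫ b.symm⟩
    refine ⟨hX, ?_, hZ 0 hX⟩
    intro S hS h
    have := hS.mono_f
    obtain ⟨j, k, w, hjk, hj, hk⟩ := exists_shortExact_cokernel hS (Injective.ι S.X₂)
    have hE := shortExact_cokernel (S.f ≫ Injective.ι S.X₂)
    have hE' := shortExact_cokernel (Injective.ι S.X₂)
    have : Injective (Injective.under S.X₂) := inferInstance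
    have hW : Acyclic T (cokernel (S.f ≫ Injective.ι S.X₂)) := acyclic_of_injective T hE h
    obtain ⟨a⟩ := rightDerived_one_iso_of_injective T hE'
    obtain ⟨b⟩ := rightDerived_one_iso T hjk (hW 0)
    obtain ⟨c⟩ := nonempty_cokernel_iso (T.map (cokernel.π (Injective.ι S.X₂))) (T.map k)
      (𝟙 _) (fun e => ⟨T.map (cokernel.π _) e, map_comp_apply_eq' T hk e⟩)
      (fun d => ⟨d, 0, by rw [map_zero, add_zero]; rfl⟩) (fun x q hx => by
        obtain ⟨e, rfl⟩ := map_g_surjective_of_isZero T hE (h 0) q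
        exact ⟨e, (map_comp_apply_eq' T hk e).symm.trans hx.symm⟩)
    exact ⟨a ≪≫ c ≪≫ b.symm⟩
  | succ p ih =>
    obtain ⟨ihX, ihY, ihZ⟩ := ih
    have hX : ∀ S : ShortComplex 𝒞, S.ShortExact → Acyclic T S.X₃ →
        Function.Surjective (T.map S.g) →
        Nonempty ((T.rightDerived (p + 2)).obj S.X₁ ≅ (T.rightDerived (p + 2)).obj S.X₂) := by
      intro S hS h hs
      have := hS.mono_f
      obtain ⟨j, k, w, hjk, hj, hk⟩ := exists_shortExact_cokernel hS (Injective.ι S.X₂)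
      have hE := shortExact_cokernel (S.f ≫ Injective.ι S.X₂)
      have hE' := shortExact_cokernel (Injective.ι S.X₂)
      have : Injective (Injective.under S.X₂) := inferInstance
      obtain ⟨a⟩ := rightDerived_shift_of_injective T hE p
      obtain ⟨b⟩ := rightDerived_shift_of_injective T hE' p
      obtain ⟨c⟩ := ihY _ hjk h
      exact ⟨a ≪≫ c ≪≫ b.symm⟩
    refine ⟨hX, ?_, hZ (p + 1) hX⟩
    intro S hS h
    have := hS.mono_f
    obtain ⟨j, k, w, hjk, hj, hk⟩ := exists_shortExact_cokernel hS (Injective.ι S.X₂)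
    have hE := shortExact_cokernel (S.f ≫ Injective.ι S.X₂)
    have hE' := shortExact_cokernel (Injective.ι S.X₂)
    have : Injective (Injective.under S.X₂) := inferInstance
    have hW : Acyclic T (cokernel (S.f ≫ Injective.ι S.X₂)) := acyclic_of_injective T hE h
    obtain ⟨a⟩ := rightDerived_shift_of_injective T hE' p
    obtain ⟨b⟩ := ihZ _ hjk hW
    exact ⟨a ≪≫ b.symm⟩

/-- Dimension shifting along an embedding into an acyclic object. -/
theorem rightDerived_shift {S : ShortComplex 𝒞} (hS : S.ShortExact) (h : Acyclic T S.X₂) (p : ℕ) :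
    Nonempty ((T.rightDerived (p + 2)).obj S.X₁ ≅ (T.rightDerived (p + 1)).obj S.X₃) :=
  (rightDerived_iso_aux T p).2.2 S hS h

/-- A class of objects that embed into acyclic objects, with the quotient in the class and
with surjective `T.map S.g`, consists of acyclic objects. -/
theorem acyclic_of_class (P : 𝒞 → Prop) (h : ∀ A, P A → ∃ S : ShortComplex 𝒞, S.ShortExact ∧
    S.X₁ = A ∧ Acyclic T S.X₂ ∧ P S.X₃ ∧ Function.Surjective (T.map S.g)) (A : 𝒞) (hA : P A) :
    Acyclic T A := by
  intro p
  induction p generalizing A with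
  | zero =>
    obtain ⟨S, hS, rfl, h₂, -, hs⟩ := h A hA
    exact ((isZero_cokernel_iff _).2 hs).of_iso (rightDerived_one_iso T hS (h₂ 0)).some
  | succ p ih =>
    obtain ⟨S, hS, rfl, h₂, h₃, -⟩ := h A hA
    exact (ih _ h₃).of_iso (rightDerived_shift T hS h₂ p).some

/-- The cokernel of `f` embeds in `K.X (m + 1)` and is resolved by the rest of `K`. Passing to it
raises `m` and lowers `p` by one with `n = m + p` fixed, until degree one is reached, where both
sides are a cokernel. -/
theorem rightDerived_iso_homology_succ (K : CochainComplex 𝒞 ℕ) (hK : ∀ n, Acyclic T (K.X n))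
    (p : ℕ) : ∀ (m n : ℕ) (_ : n = m + p) (F : 𝒞) (f : F ⟶ K.X m) (w : f ≫ K.d m (m + 1) = 0)
      (_ : Mono f) (_ : (ShortComplex.mk f (K.d m (m + 1)) w).Exact)
      (_ : ∀ i, m ≤ i → K.ExactAt (i + 1)), Nonempty ((T.rightDerived (p + 1)).obj F ≅
        ((T.mapHomologicalComplex (ComplexShape.up ℕ)).obj K).homology (n + 1)) := by
  induction p with
  | zero =>
    rintro m n hn F f w hf h₀ h
    obtain rfl : m = n := by omega
    obtain ⟨e, w', he, hexact, hfac⟩ := exists_mono_cokernel_desc K m f w h₀ (h m le_rfl)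
    obtain ⟨a⟩ := rightDerived_one_iso T (shortExact_cokernel f) (hK m 0)
    refine ⟨a ≪≫ (mapHomologyIso T K m ≪≫ ?_).symm⟩
    exact homologyIsoCokernel (S := ShortComplex.mk (T.map (K.d m (m + 1)))
      (T.map (K.d (m + 1) (m + 2))) (by rw [← T.map_comp, K.d_comp_d, T.map_zero]))
      (Z := T.obj (cokernel f)) (T.map e) (T.map_mono e)
      (show T.map e ≫ T.map (K.d (m + 1) (m + 2)) = 0 by
        rw [← T.map_comp, w', Functor.map_zero])
      (hexact.map_of_mono_of_preservesKernel T he inferInstance) (T.map (cokernel.π f))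
      ((T.map_comp _ _).symm.trans (congrArg T.map hfac))
  | succ p ih =>
    rintro m n hn F f w hf h₀ h
    obtain ⟨e, w', he, hexact, hfac⟩ := exists_mono_cokernel_desc K m f w h₀ (h m le_rfl)
    obtain ⟨a⟩ := rightDerived_shift T (shortExact_cokernel f) (hK m) p
    obtain ⟨b⟩ := ih (m + 1) n (by omega) _ e w' he hexact (fun i hi => h i (by omega))
    exact ⟨a ≪≫ b⟩

/-- Resolutions by acyclic objects compute the derived functors. -/
theorem rightDerived_iso_homology {F : 𝒞} (K : CochainComplex 𝒞 ℕ) (hK : ∀ n, Acyclic T (K.X n))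
    (ε : (CochainComplex.single₀ 𝒞).obj F ⟶ K) (hε : QuasiIso ε) (p : ℕ) :
    Nonempty ((T.rightDerived p).obj F ≅
      ((T.mapHomologicalComplex (ComplexShape.up ℕ)).obj K).homology p) := by
  obtain ⟨f, w, hf, h₀, h⟩ := exists_of_quasiIso_single₀ ε hε
  cases p with
  | zero =>
    refine ⟨T.rightDerivedZeroIsoSelf.app F ≪≫
      (cokernelZeroIsoTarget (X := T.obj (K.X 0)) (Y := T.obj F)).symm ≪≫
      (ShortComplex.homologyMapIso
        (HomologicalComplex.isoSc' _ 0 0 1 (by simp) (by simp)) ≪≫ ?_).symm⟩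
    -- In degree 0 the incoming differential is `d 0 0 = 0`, so the homology is the cokernel of the
    -- zero map into the kernel `T F`.
    refine homologyIsoCokernel (Z := T.obj F) (T.map f) (T.map_mono f) ?_ ?_ 0 ?_
    · exact show T.map f ≫ T.map (K.d 0 1) = 0 by rw [← T.map_comp, w, Functor.map_zero]
    · exact h₀.map_of_mono_of_preservesKernel T hf inferInstance
    · exact zero_comp.trans (((T.mapHomologicalComplex (ComplexShape.up ℕ)).obj K).shape 0 0 (by simp)).symm
  | succ p =>
    exact rightDerived_iso_homology_succ T K hK p 0 p (by omega) F f w hf h₀ (fun i _ => h i)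

end Acyclic

end

end HigherOrder

namespace HigherOrder

noncomputable section

/-! ### Sheaves described by their germs. -/

section SheafBasics

open Limits

variable {R : Type u} [CommRing R] {Y : TopCat.{u}}

/-- The map on stalks induced by a morphism of sheaves. -/
def stalkMap {F G : TopCat.Sheaf (ModuleCat.{u} R) Y} (f : F ⟶ G) (y : Y) :
    F.presheaf.stalk y →ₗ[R] G.presheaf.stalk y :=
  ((TopCat.Presheaf.stalkFunctor _ y).map f.hom).hom

theorem stalkMap_germ {F G : TopCat.Sheaf (ModuleCat.{u} R) Y} (f : F ⟶ G) {U : Opens Y} {y : Y}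
    (hy : y ∈ U) (t : F.presheaf.obj (op U)) :
    stalkMap f y (F.presheaf.germ U y hy t) = G.presheaf.germ U y hy (f.hom.app (op U) t) :=
  TopCat.Presheaf.stalkFunctor_map_germ_apply U y hy f.hom t

theorem stalkMap_comp {F G H : TopCat.Sheaf (ModuleCat.{u} R) Y} (f : F ⟶ G) (g : G ⟶ H) (y : Y)
    (a : F.presheaf.stalk y) : stalkMap (f ≫ g) y a = stalkMap g y (stalkMap f y a) := by
  show ((TopCat.Presheaf.stalkFunctor _ y).map (f.hom ≫ g.hom)).hom a = _
  rw [Functor.map_comp]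
  rfl

theorem germ_res {F : TopCat.Sheaf (ModuleCat.{u} R) Y} {U V : Opens Y} (h : U ≤ V) {y : Y}
    (hy : y ∈ U) (t : F.presheaf.obj (op V)) :
    F.presheaf.germ U y hy (F.presheaf.map (homOfLE h).op t) = F.presheaf.germ V y (h hy) t :=
  F.presheaf.germ_res_apply (homOfLE h) y hy t

theorem exists_germ {F : TopCat.Sheaf (ModuleCat.{u} R) Y} {y : Y} (a : F.presheaf.stalk y)
    {V : Opens Y} (hV : y ∈ V) : ∃ (U : Opens Y) (_ : U ≤ V) (hy : y ∈ U)
      (t : F.presheaf.obj (op U)), F.presheaf.germ U y hy t = a := by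
  obtain ⟨U, hU, hy, t, ht⟩ := F.presheaf.exists_le_germ_eq a hV
  exact ⟨U, hU, hy, t, ht⟩

theorem exists_nhds_germ_eq {F : TopCat.Sheaf (ModuleCat.{u} R) Y} {U V : Opens Y} {y : Y}
    (hU : y ∈ U) (hV : y ∈ V) (s : F.presheaf.obj (op U)) (t : F.presheaf.obj (op V))
    (h : F.presheaf.germ U y hU s = F.presheaf.germ V y hV t) :
    ∃ (W : Opens Y) (hWU : W ≤ U) (hWV : W ≤ V), y ∈ W ∧ ∀ (z : Y) (hz : z ∈ W),
      F.presheaf.germ U z (hWU hz) s = F.presheaf.germ V z (hWV hz) t := by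
  obtain ⟨W, hW, i, j, e⟩ := F.presheaf.germ_eq y hU hV s t h
  refine ⟨W, i.le, j.le, hW, fun z hz => ?_⟩
  rw [← F.presheaf.germ_res_apply i z hz, ← F.presheaf.germ_res_apply j z hz]
  exact congrArg _ e

theorem section_ext {F : TopCat.Sheaf (ModuleCat.{u} R) Y} {U : Opens Y}
    {s t : F.presheaf.obj (op U)}
    (h : ∀ (y : Y) (hy : y ∈ U), F.presheaf.germ U y hy s = F.presheaf.germ U y hy t) : s = t :=
  TopCat.Presheaf.section_ext F U s t h

/-- A family of germs that is given near every point of `U` by a section of the sheaf. -/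
def IsLocallySection (F : TopCat.Sheaf (ModuleCat.{u} R) Y) (U : Opens Y)
    (s : ∀ y : Y, F.presheaf.stalk y) : Prop :=
  ∀ y ∈ U, ∃ (V : Opens Y) (_ : y ∈ V) (t : F.presheaf.obj (op V)),
    ∀ (z : Y) (hz : z ∈ V), s z = F.presheaf.germ V z hz t

/-- Local sections with prescribed germs agree on overlaps, since germs determine sections, and so
they glue. All sections below are built by prescribing germs. -/
theorem IsLocallySection.exists_section {F : TopCat.Sheaf (ModuleCat.{u} R) Y} {U : Opens Y}
    {s : ∀ y : Y, F.presheaf.stalk y} (hs : IsLocallySection F U s) :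
    ∃ t : F.presheaf.obj (op U), ∀ (y : Y) (hy : y ∈ U), F.presheaf.germ U y hy t = s y := by
  choose V hV t ht using fun y : U => hs y.1 y.2
  obtain ⟨r, hr, -⟩ := F.existsUnique_gluing' (fun y : U => V y ⊓ U) U
    (fun y => homOfLE inf_le_right)
    (fun y hy => Opens.mem_iSup.2 ⟨⟨y, hy⟩, show y ∈ V ⟨y, hy⟩ ⊓ U from ⟨hV _, hy⟩⟩)
    (fun y => F.presheaf.map (homOfLE inf_le_left).op (t y)) (fun x y => by
      refine section_ext fun z hz => ?_
      refine (F.presheaf.germ_res_apply _ z hz _).trans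
        (Eq.trans ?_ (F.presheaf.germ_res_apply _ z hz _).symm)
      rw [germ_res, germ_res, ← ht, ← ht])
  refine ⟨r, fun y hy => ?_⟩
  have hmem : y ∈ V ⟨y, hy⟩ ⊓ U := ⟨hV ⟨y, hy⟩, hy⟩
  have h := congrArg (F.presheaf.germ (V ⟨y, hy⟩ ⊓ U) y hmem) (hr ⟨y, hy⟩)
  replace h := h.trans (germ_res _ _ _)
  rw [ht ⟨y, hy⟩ y (hV _)]
  exact (F.presheaf.germ_res_apply _ y _ _).symm.trans h

section Exactness

theorem stalkMap_injective {F G : TopCat.Sheaf (ModuleCat.{u} R) Y} (f : F ⟶ G) [Mono f] (y : Y) :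
    Function.Injective (stalkMap f y) :=
  (ModuleCat.mono_iff_injective _).1 (TopCat.Presheaf.stalk_mono_of_mono f y)

theorem mono_of_stalkMap_injective {F G : TopCat.Sheaf (ModuleCat.{u} R) Y} (f : F ⟶ G)
    (h : ∀ y, Function.Injective (stalkMap f y)) : Mono f :=
  have := fun y => (ModuleCat.mono_iff_injective _).2 (h y)
  TopCat.Presheaf.mono_of_stalk_mono f

theorem stalkMap_surjective {F G : TopCat.Sheaf (ModuleCat.{u} R) Y} (f : F ⟶ G) [hf : Epi f]
    (y : Y) : Function.Surjective (stalkMap f y) :=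
  (TopCat.Presheaf.locally_surjective_iff_surjective_on_stalks f.hom).1
    ((TopCat.Sheaf.isLocallySurjective_iff_epi f).2 hf) y

theorem stalkMap_exact {S : ShortComplex (TopCat.Sheaf (ModuleCat.{u} R) Y)} (hS : S.Exact) (y : Y)
    (b : S.X₂.presheaf.stalk y) (hb : stalkMap S.g y b = 0) : ∃ a, stalkMap S.f y a = b :=
  (ShortComplex.moduleCat_exact_iff _).1
    ((TopCat.Sheaf.exact_iff_stalkFunctor_map_exact S).1 hS y) b hb

theorem stalkMap_comp_eq_zero (S : ShortComplex (TopCat.Sheaf (ModuleCat.{u} R) Y)) (y : Y)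
    (a : S.X₁.presheaf.stalk y) : stalkMap S.g y (stalkMap S.f y a) = 0 := by
  rw [← stalkMap_comp, S.zero]
  show ((TopCat.Presheaf.stalkFunctor (ModuleCat.{u} R) y).map
    (0 : S.X₁.presheaf ⟶ S.X₃.presheaf)).hom a = 0
  rw [Functor.map_zero]
  rfl

/-- If a monomorphism maps a family of germs to a family given by a section near `y`, then the
original family is given by a section near `y`. -/
theorem exists_section_of_stalkMap {F G : TopCat.Sheaf (ModuleCat.{u} R) Y} (f : F ⟶ G) [Mono f]
    {y : Y} (a : F.presheaf.stalk y) {V : Opens Y} (hy : y ∈ V) (t : G.presheaf.obj (op V))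
    (h : stalkMap f y a = G.presheaf.germ V y hy t) :
    ∃ (W : Opens Y) (hW : W ≤ V) (_ : y ∈ W) (r : F.presheaf.obj (op W)), ∀ (z : Y) (hz : z ∈ W)
      (a' : F.presheaf.stalk z), stalkMap f z a' = G.presheaf.germ V z (hW hz) t →
        a' = F.presheaf.germ W z hz r := by
  obtain ⟨U, hU, hyU, r, rfl⟩ := exists_germ a hy
  rw [stalkMap_germ] at h
  obtain ⟨W, hWU, hWV, hyW, hW⟩ := exists_nhds_germ_eq _ _ _ _ h
  refine ⟨W, hWV, hyW, F.presheaf.map (homOfLE hWU).op r, fun z hz a' ha' => ?_⟩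
  apply stalkMap_injective f z
  rw [ha', ← hW z hz, germ_res, stalkMap_germ]

/-- Preimages of the germs of `b` exist by exactness on stalks. They are unique because `S.f` is
mono, and this forces them to come from sections locally. -/
theorem section_exact {S : ShortComplex (TopCat.Sheaf (ModuleCat.{u} R) Y)} (hS : S.ShortExact)
    {U : Opens Y} (b : S.X₂.presheaf.obj (op U)) (hb : S.g.hom.app (op U) b = 0) :
    ∃ a : S.X₁.presheaf.obj (op U), S.f.hom.app (op U) a = b := by
  have := hS.mono_f
  have hx : ∀ y, ∃ a, ∀ hy : y ∈ U, stalkMap S.f y a = S.X₂.presheaf.germ U y hy b := by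
    intro y
    by_cases hy : y ∈ U
    · obtain ⟨a, ha⟩ := stalkMap_exact hS.exact y (S.X₂.presheaf.germ U y hy b) (by
        rw [stalkMap_germ, hb, map_zero])
      exact ⟨a, fun _ => ha⟩
    · exact ⟨0, fun h => absurd h hy⟩
  choose a ha using hx
  have hsec : IsLocallySection S.X₁ U a := by
    intro y hy
    obtain ⟨W, hW, hyW, r, hr⟩ := exists_section_of_stalkMap S.f (a y) hy b (ha y hy)
    exact ⟨W, hyW, r, fun z hz => hr z hz _ (ha z (hW hz))⟩
  obtain ⟨t, ht⟩ := hsec.exists_section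
  refine ⟨t, section_ext fun y hy => ?_⟩
  rw [← stalkMap_germ, ht, ha y hy]

end Exactness

/-! ### Flasque sheaves: lifting sections by Zorn's lemma. -/

section Flasque

variable {F : TopCat.Sheaf (ModuleCat.{u} R) Y}

theorem isFlasque_iff : F.IsFlasque ↔ ∀ (U V : Opens Y) (h : U ≤ V) (t : F.presheaf.obj (op U)),
    ∃ r : F.presheaf.obj (op V), F.presheaf.map (homOfLE h).op r = t := by
  constructor
  · intro hF U V h
    exact (ModuleCat.epi_iff_surjective _).1 (hF.epi (homOfLE h).op)
  · intro hF
    refine ⟨fun {U V} i => (ModuleCat.epi_iff_surjective _).2 (hF _ _ i.unop.le)⟩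

/-- A lift of a section `c` of `S.X₃` over `U` to a section of `S.X₂` over a smaller open set. -/
structure PartialLift (S : ShortComplex (TopCat.Sheaf (ModuleCat.{u} R) Y)) (U : Opens Y)
    (c : S.X₃.presheaf.obj (op U)) where
  /-- The domain of the lift. -/
  domain : Opens Y
  /-- The lift. -/
  lift : S.X₂.presheaf.obj (op domain)
  le : domain ≤ U
  map_germ : ∀ (y : Y) (hy : y ∈ domain), stalkMap S.g y (S.X₂.presheaf.germ _ y hy lift) =
    S.X₃.presheaf.germ U y (le hy) c

namespace PartialLift

variable {S : ShortComplex (TopCat.Sheaf (ModuleCat.{u} R) Y)} {U : Opens Y}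
  {c : S.X₃.presheaf.obj (op U)}

/-- The extension relation on partial lifts. -/
def Extends (p q : PartialLift S U c) : Prop :=
  ∃ h : p.domain ≤ q.domain, ∀ (y : Y) (hy : y ∈ p.domain),
    S.X₂.presheaf.germ _ y hy p.lift = S.X₂.presheaf.germ _ y (h hy) q.lift

theorem exists_of_isLocallySection {V : Opens Y} (hV : V ≤ U) {s : ∀ y, S.X₂.presheaf.stalk y}
    (hs : IsLocallySection S.X₂ V s) (hc : ∀ (y : Y) (hy : y ∈ V),
      stalkMap S.g y (s y) = S.X₃.presheaf.germ U y (hV hy) c) :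
    ∃ p : PartialLift S U c, V ≤ p.domain ∧
      ∀ (y : Y) (hy : y ∈ p.domain), S.X₂.presheaf.germ _ y hy p.lift = s y := by
  obtain ⟨t, ht⟩ := hs.exists_section
  exact ⟨⟨V, t, hV, fun y hy => by rw [ht]; exact hc y hy⟩, le_rfl, ht⟩

theorem exists_upper_bound (ch : Set (PartialLift S U c)) (hch : IsChain Extends ch) :
    ∃ p : PartialLift S U c, ∀ q ∈ ch, Extends q p := by
  have hcompat : ∀ p ∈ ch, ∀ q ∈ ch, ∀ (y : Y) (hp : y ∈ p.domain) (hq : y ∈ q.domain),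
      S.X₂.presheaf.germ _ y hp p.lift = S.X₂.presheaf.germ _ y hq q.lift := by
    intro p hp q hq y hyp hyq
    by_cases hne : p = q
    · subst hne
      rfl
    · rcases hch hp hq hne with ⟨h, e⟩ | ⟨h, e⟩
      · exact e y hyp
      · exact (e y hyq).symm
  have hx : ∀ y, ∃ a : S.X₂.presheaf.stalk y, ∀ p ∈ ch, ∀ hy : y ∈ p.domain,
      S.X₂.presheaf.germ _ y hy p.lift = a := by
    intro y
    by_cases hy : ∃ p ∈ ch, y ∈ p.domain
    · obtain ⟨p, hp, hyp⟩ := hy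
      exact ⟨_, fun q hq hyq => hcompat q hq p hp y hyq hyp⟩
    · exact ⟨0, fun p hp hyp => absurd ⟨p, hp, hyp⟩ hy⟩
  choose s hs using hx
  obtain ⟨p, hpV, hp⟩ := exists_of_isLocallySection (c := c) (V := ⨆ p : ch, p.1.domain)
    (iSup_le fun p => p.1.le) (s := s) (fun y hy => by
      obtain ⟨p, hp⟩ := Opens.mem_iSup.1 hy
      exact ⟨p.1.domain, hp, p.1.lift, fun z hz => (hs z p.1 p.2 hz).symm⟩) (fun y hy => by
      obtain ⟨p, hp⟩ := Opens.mem_iSup.1 hy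
      rw [← hs y p.1 p.2 hp]
      exact p.1.map_germ _ _)
  refine ⟨p, fun q hq => ⟨(le_iSup (fun p : ch => p.1.domain) ⟨q, hq⟩).trans hpV, fun y hy => ?_⟩⟩
  rw [hp]
  exact hs y q hq hy

/-- A local lift `b` near `x` differs from `m.lift` on the overlap by a section of `S.X₁`.
Flasqueness extends this difference to the whole neighbourhood, and `b` corrected by it glues with
`m.lift`. -/
theorem exists_extends (hS : S.ShortExact) (hF : S.X₁.IsFlasque) (m : PartialLift S U c) {x : Y}
    (hx : x ∈ U) : ∃ p : PartialLift S U c, m.Extends p ∧ x ∈ p.domain := by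
  have := hS.mono_f
  have := hS.epi_g
  rw [isFlasque_iff] at hF
  obtain ⟨b, hb⟩ := stalkMap_surjective S.g x (S.X₃.presheaf.germ U x hx c)
  obtain ⟨W, hWU, hxW, b, rfl⟩ := exists_germ b hx
  rw [stalkMap_germ] at hb
  obtain ⟨W', hW'W, hW'U, hxW', hW'⟩ := exists_nhds_germ_eq _ _ _ _ hb
  obtain ⟨a, ha⟩ := section_exact hS (U := m.domain ⊓ W')
    (S.X₂.presheaf.map (homOfLE inf_le_left).op m.lift -
      S.X₂.presheaf.map (homOfLE (inf_le_right.trans hW'W)).op b) (by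
    refine section_ext fun y hy => ?_
    rw [← stalkMap_germ, map_sub, map_sub, germ_res, germ_res, m.map_germ, stalkMap_germ,
      hW' y hy.2, sub_self, map_zero])
  obtain ⟨a', ha'⟩ := hF _ W' inf_le_right a
  have key : ∀ (y : Y) (hy : y ∈ m.domain) (hy' : y ∈ W'), S.X₂.presheaf.germ _ y hy m.lift =
      S.X₂.presheaf.germ _ y (hW'W hy') b + stalkMap S.f y (S.X₁.presheaf.germ W' y hy' a') := by
    intro y hy hy'
    have hmem : y ∈ m.domain ⊓ W' := ⟨hy, hy'⟩
    have := congrArg (S.X₂.presheaf.germ (m.domain ⊓ W') y hmem) ha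
    rw [map_sub, germ_res, germ_res, ← stalkMap_germ, ← ha', germ_res] at this
    rw [this]
    abel
  have hx' : ∀ y, ∃ e : S.X₂.presheaf.stalk y, (∀ hy : y ∈ m.domain,
      S.X₂.presheaf.germ _ y hy m.lift = e) ∧ (∀ hy' : y ∈ W', S.X₂.presheaf.germ _ y (hW'W hy') b +
        stalkMap S.f y (S.X₁.presheaf.germ W' y hy' a') = e) := by
    intro y
    by_cases hy : y ∈ m.domain
    · exact ⟨_, fun _ => rfl, fun hy' => (key y hy hy').symm⟩
    · by_cases hy' : y ∈ W'
      · exact ⟨S.X₂.presheaf.germ _ y (hW'W hy') b +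
          stalkMap S.f y (S.X₁.presheaf.germ W' y hy' a'), fun h => absurd h hy, fun _ => rfl⟩
      · exact ⟨0, fun h => absurd h hy, fun h => absurd h hy'⟩
  choose s hs hs' using hx'
  obtain ⟨p, hpV, hp⟩ := exists_of_isLocallySection (c := c) (V := m.domain ⊔ W')
    (sup_le m.le hW'U) (s := s) (fun y hy => by
      rcases hy with hy | hy
      · exact ⟨_, hy, m.lift, fun z hz => (hs z hz).symm⟩
      · refine ⟨W', hy, S.X₂.presheaf.map (homOfLE hW'W).op b + S.f.hom.app (op W') a',
          fun z hz => ?_⟩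
        rw [map_add, germ_res, ← stalkMap_germ, hs' z hz]) (fun y hy => by
      rcases hy with hy | hy
      · rw [← hs y hy, m.map_germ]
      · rw [← hs' y hy, map_add, stalkMap_comp_eq_zero, add_zero, stalkMap_germ, hW' y hy])
  exact ⟨p, ⟨le_sup_left.trans hpV, fun y hy => by rw [hp, hs y hy]⟩, hpV (Or.inr hxW')⟩

end PartialLift

/-- Sections over `U` lift along an epimorphism with flasque kernel. -/
theorem section_surjective_of_isFlasque {S : ShortComplex (TopCat.Sheaf (ModuleCat.{u} R) Y)}
    (hS : S.ShortExact) (hF : S.X₁.IsFlasque) (U : Opens Y) (c : S.X₃.presheaf.obj (op U)) :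
    ∃ b : S.X₂.presheaf.obj (op U), S.g.hom.app (op U) b = c := by
  obtain ⟨m, hm⟩ := exists_maximal_of_chains_bounded (r := PartialLift.Extends (c := c))
    PartialLift.exists_upper_bound (fun {a b c} hab hbc => ⟨hab.1.trans hbc.1, fun y hy =>
      (hab.2 y hy).trans (hbc.2 y (hab.1 hy))⟩)
  have hU : U ≤ m.domain := by
    intro x hx
    obtain ⟨p, hp, hxp⟩ := m.exists_extends hS hF hx
    exact (hm p hp).1 hxp
  refine ⟨S.X₂.presheaf.map (homOfLE hU).op m.lift, section_ext fun y hy => ?_⟩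
  rw [← stalkMap_germ, germ_res, m.map_germ]

theorem isFlasque_of_shortExact {S : ShortComplex (TopCat.Sheaf (ModuleCat.{u} R) Y)}
    (hS : S.ShortExact) (h₁ : S.X₁.IsFlasque) (h₂ : S.X₂.IsFlasque) : S.X₃.IsFlasque := by
  rw [isFlasque_iff]
  intro U V h t
  obtain ⟨b, rfl⟩ := section_surjective_of_isFlasque hS h₁ U t
  obtain ⟨b', rfl⟩ := isFlasque_iff.1 h₂ U V h b
  refine ⟨S.g.hom.app (op V) b', section_ext fun y hy => ?_⟩
  rw [germ_res, ← stalkMap_germ, ← stalkMap_germ, germ_res]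

end Flasque

/-! ### Injective sheaves: extension from subpresheaves, flasqueness. -/

section Injective

/-- The presheaf of submodules of a presheaf. -/
def subpresheaf (Q : (Opens Y)ᵒᵖ ⥤ ModuleCat.{u} R) (N : ∀ U, Submodule R (Q.obj U))
    (hN : ∀ {U V} (i : U ⟶ V) (x : Q.obj U), x ∈ N U → Q.map i x ∈ N V) :
    (Opens Y)ᵒᵖ ⥤ ModuleCat.{u} R where
  obj U := ModuleCat.of R (N U)
  map i := ModuleCat.ofHom ((Q.map i).hom.restrict (hN i))
  map_id U := by
    ext x
    exact ConcreteCategory.congr_hom (Q.map_id U) x.1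
  map_comp i j := by
    ext x
    exact ConcreteCategory.congr_hom (Q.map_comp i j) x.1

/-- A morphism from a presheaf of submodules to an injective sheaf extends. -/
theorem exists_extension {I : TopCat.Sheaf (ModuleCat.{u} R) Y} (hI : Injective I)
    (Q : (Opens Y)ᵒᵖ ⥤ ModuleCat.{u} R) (N : ∀ U, Submodule R (Q.obj U))
    (hN : ∀ {U V} (i : U ⟶ V) (x : Q.obj U), x ∈ N U → Q.map i x ∈ N V)
    (φ : subpresheaf Q N hN ⟶ I.obj) :
    ∃ ψ : Q ⟶ I.obj, ∀ U (x : N U), ψ.app U x.1 = φ.app U x := by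
  let ι : subpresheaf Q N hN ⟶ Q :=
    { app := fun U => ModuleCat.ofHom (N U).subtype
      naturality := fun _ _ _ => rfl }
  have : ∀ U, Mono (ι.app U) := fun U =>
    (ModuleCat.mono_iff_injective _).2 Subtype.val_injective
  have : Mono ι := NatTrans.mono_of_mono_app ι
  -- The inclusion of sheaves into presheaves is right adjoint to sheafification, which preserves
  -- monomorphisms, so it preserves injectives.
  have hI' : Injective I.obj :=
    @Injective.injective_of_adjoint _ _ _ _ _ _ _ (CategoryTheory.sheafificationAdjunction
      (Opens.grothendieckTopology Y) (ModuleCat.{u} R)) I hI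
  refine ⟨Injective.factorThru φ ι, fun U x => ?_⟩
  exact ConcreteCategory.congr_hom (NatTrans.congr_app (Injective.comp_factorThru φ ι) U) x

/-- The section `t` is a morphism to `I` from the presheaf that is `R` on open sets inside `U` and
zero on the others. Extended to the constant presheaf `R`, it gives the required section as the
image of `1` over `V`. -/
theorem isFlasque_of_injective {I : TopCat.Sheaf (ModuleCat.{u} R) Y} (hI : Injective I) :
    I.IsFlasque := by
  rw [isFlasque_iff]
  intro U V h t
  let Q : (Opens Y)ᵒᵖ ⥤ ModuleCat.{u} R := (Functor.const _).obj (ModuleCat.of R R)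
  let N : ∀ W, Submodule R (Q.obj W) := fun W =>
    { carrier := {r : R | unop W ≤ U ∨ r = 0}
      add_mem' := by
        rintro a b (ha | ha) (hb | hb)
        · exact Or.inl ha
        · exact Or.inl ha
        · exact Or.inl hb
        · exact Or.inr (by rw [ha, hb, add_zero])
      zero_mem' := Or.inr rfl
      smul_mem' := by
        rintro c a (ha | ha)
        · exact Or.inl ha
        · exact Or.inr (by rw [ha, smul_zero]) }
  have hN : ∀ {W W'} (i : W ⟶ W') (x : Q.obj W), x ∈ N W → Q.map i x ∈ N W' := by
    rintro W W' i x (hx | hx)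
    · exact Or.inl (i.unop.le.trans hx)
    · exact Or.inr hx
  classical
  let e : ∀ W : (Opens Y)ᵒᵖ, I.presheaf.obj W := fun W =>
    if hW : unop W ≤ U then I.presheaf.map (homOfLE hW).op t else 0
  let φ : subpresheaf Q N hN ⟶ I.obj :=
    { app := fun W => ModuleCat.ofHom ((LinearMap.toSpanSingleton R _ (e W)).comp (N W).subtype)
      naturality := fun W W' i => by
        ext ⟨x, hx⟩
        show x • e W' = I.presheaf.map i (x • e W)
        rw [map_smul]
        rcases hx with hx | rfl
        · congr 1
          simp only [e]
          rw [dif_pos hx, dif_pos (i.unop.le.trans hx)]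
          refine section_ext (U := unop W') fun y hy => ?_
          rw [germ_res]
          exact ((I.presheaf.germ_res_apply i.unop y hy _).trans (germ_res hx _ t)).symm
        · rw [zero_smul, zero_smul] }
  obtain ⟨ψ, hψ⟩ := exists_extension hI Q N hN φ
  refine ⟨ψ.app (op V) (1 : R), ?_⟩
  have h₁ := ConcreteCategory.congr_hom (ψ.naturality (homOfLE h).op) (1 : R)
  have h₂ := hψ (op U) ⟨(1 : R), Or.inl le_rfl⟩
  refine h₁.symm.trans (h₂.trans ?_)
  show (1 : R) • e (op U) = t
  rw [one_smul]
  simp only [e]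
  rw [dif_pos le_rfl]
  refine section_ext fun y hy => ?_
  rw [germ_res]

end Injective

/-! ### Flasque sheaves are acyclic for global sections. -/

section GlobalSections

instance : PreservesFiniteLimits (globalSections R Y) := by
  have h : PreservesFiniteLimits (CategoryTheory.sheafToPresheaf (Opens.grothendieckTopology Y)
    (ModuleCat.{u} R)) := inferInstance
  have h' : PreservesFiniteLimits ((evaluation (Opens Y)ᵒᵖ (ModuleCat.{u} R)).obj (op ⊤)) :=
    inferInstance
  exact @comp_preservesFiniteLimits _ _ _ _ _ _ _ _ h h'

theorem isAcyclicFor_iff (T : TopCat.Sheaf (ModuleCat.{u} R) Y ⥤ ModuleCat.{u} R) [T.Additive]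
    (F : TopCat.Sheaf (ModuleCat.{u} R) Y) : IsAcyclicFor T F ↔ Acyclic T F :=
  ⟨fun h p => h (p + 1) (by omega), fun h p hp => by
    obtain ⟨p, rfl⟩ := Nat.exists_eq_add_of_le' hp
    exact h p⟩

theorem acyclic_of_isFlasque {F : TopCat.Sheaf (ModuleCat.{u} R) Y} (hF : F.IsFlasque) :
    Acyclic (globalSections R Y) F := by
  refine acyclic_of_class (globalSections R Y) (fun F => F.IsFlasque) (fun A hA => ?_) F hF
  have hS := shortExact_cokernel (Injective.ι A)
  refine ⟨_, hS, rfl, fun p => ?_, ?_, fun c => ?_⟩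
  · exact Functor.isZero_rightDerived_obj_injective_succ _ _ _
  · exact isFlasque_of_shortExact hS hA (isFlasque_of_injective inferInstance)
  · exact section_surjective_of_isFlasque hS hA ⊤ c

end GlobalSections

end SheafBasics

end

end HigherOrder

namespace HigherOrder

noncomputable section

/-! ### The universal covering as a principal covering. -/

section Galois

variable {X Y : Type u} [TopologicalSpace X] [TopologicalSpace Y]

/-- The properties of the universal covering that matter for sheaf cohomology: it is a surjective
local homeomorphism, and its deck transformations act simply transitively on the fibres. -/
structure IsPrincipalCovering (π : X → Y) : Prop where
  isLocalHomeomorph : IsLocalHomeomorph π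
  surjective : Function.Surjective π
  exists_deck : ∀ x x' : X, π x = π x' → ∃ g : deck π, g.1 x = x'
  eq_one : ∀ (g : deck π) (x : X), g.1 x = x → g = 1

theorem LocallySimplyConnected.locallyPathConnectedSpace (hY : LocallySimplyConnected Y) :
    LocallyPathConnectedSpace Y where
  path_connected_basis y := Filter.hasBasis_self.2 fun U hU => by
    obtain ⟨V, hV, hVU, h⟩ := hY y U hU
    exact ⟨V, hV, h.isPathConnected, hVU⟩

theorem locallyPathConnectedSpace_of_isLocalHomeomorph {π : X → Y} (hπ : IsLocalHomeomorph π)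
    [LocallyPathConnectedSpace Y] : LocallyPathConnectedSpace X where
  path_connected_basis x := Filter.hasBasis_self.2 fun U hU => by
    obtain ⟨e, hx, rfl⟩ := hπ x
    have hW : e '' (U ∩ e.source) ∈ nhds (e x) :=
      e.image_mem_nhds hx (Filter.inter_mem hU (e.open_source.mem_nhds hx))
    obtain ⟨V, ⟨hV, hVc⟩, hVW⟩ := (path_connected_basis (e x)).mem_iff.1 hW
    have hVW : V ⊆ e '' (U ∩ e.source) := hVW
    have hVt : V ⊆ e.target := fun z hz => by
      obtain ⟨w, hw, rfl⟩ := hVW hz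
      exact e.map_source hw.2
    refine ⟨e.symm '' V, ?_, hVc.image' (e.continuousOn_symm.mono hVt), ?_⟩
    · have := e.symm.image_mem_nhds (e.map_source hx) hV
      rwa [e.left_inv hx] at this
    · rintro _ ⟨z, hz, rfl⟩
      obtain ⟨w, hw, rfl⟩ := hVW hz
      rw [e.left_inv hw.2]
      exact hw.1

/-- As `X` is simply connected and locally path connected, `π` lifts through itself with any
prescribed value in the fibre. Uniqueness of lifts makes two opposite lifts inverse to each other,
and makes a deck transformation with a fixed point the identity. Surjectivity is path lifting. -/
theorem IsUniversalCovering.isPrincipalCovering [PathConnectedSpace Y]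
    (hY : LocallySimplyConnected Y) {π : X → Y} (hπ : IsUniversalCovering π) :
    IsPrincipalCovering π := by
  have hcov := hπ.isCoveringMap
  have := hπ.simplyConnected
  have := hY.locallyPathConnectedSpace
  have := locallyPathConnectedSpace_of_isLocalHomeomorph hcov.isLocalHomeomorph
  have hlift : ∀ x x' : X, π x = π x' → ∃ f : C(X, X), f x = x' ∧ π ∘ f = π := fun x x' h =>
    (hcov.existsUnique_continuousMap_lifts ⟨π, hcov.continuous⟩ x x' h.symm).exists
  have hid : ∀ f g : C(X, X), π ∘ f = π → π ∘ g = π → ∀ x, g (f x) = x → ∀ z, g (f z) = z := by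
    intro f g hf hg x hx z
    refine congrFun (hcov.eq_of_comp_eq (g.continuous.comp f.continuous) continuous_id
      (?_ : π ∘ (g ∘ f) = π ∘ id) x hx) z
    rw [← Function.comp_assoc, hg, hf]
    rfl
  refine ⟨hcov.isLocalHomeomorph, fun y => ?_, fun x x' h => ?_, fun g x hx => ?_⟩
  · let x₀ : X := Classical.arbitrary X
    obtain ⟨p⟩ := PathConnectedSpace.joined (π x₀) y
    refine ⟨hcov.liftPath p x₀ p.source 1, ?_⟩
    exact (congrFun (hcov.liftPath_lifts p x₀ p.source) 1).trans p.target
  · obtain ⟨f, hfx, hf⟩ := hlift x x' h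
    obtain ⟨g, hgx, hg⟩ := hlift x' x h.symm
    refine ⟨⟨⟨⟨f, g, ?_, ?_⟩, f.continuous, g.continuous⟩, congrFun hf⟩, hfx⟩
    · exact hid f g hf hg x (by rw [hfx, hgx])
    · exact hid g f hg hf x' (by rw [hgx, hfx])
  · refine Subtype.ext (Homeomorph.ext fun z => ?_)
    exact congrFun (hcov.eq_of_comp_eq g.1.continuous continuous_id
      (funext fun z => g.2 z : π ∘ g.1 = π ∘ id) x hx) z

namespace IsPrincipalCovering

variable {π : X → Y}

theorem eq_of_apply_eq (hπ : IsPrincipalCovering π) {g h : deck π} {x : X}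
    (e : g.1 x = h.1 x) : g = h := by
  refine (inv_mul_eq_one.1 (hπ.eq_one (g⁻¹ * h) x ?_))
  show g.1⁻¹ (h.1 x) = x
  rw [← e]
  exact g.1.symm_apply_apply x

/-- Around every point, there is a neighbourhood on which the covering is injective. -/
theorem exists_injOn (hπ : IsPrincipalCovering π) (x : X) :
    ∃ W : Set X, IsOpen W ∧ x ∈ W ∧ Set.InjOn π W := by
  obtain ⟨e, hx, rfl⟩ := hπ.isLocalHomeomorph x
  exact ⟨e.source, e.open_source, hx, e.injOn⟩

end IsPrincipalCovering

end Galois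

end

end HigherOrder

namespace HigherOrder

noncomputable section

/-! ### Homomorphisms from `R[Γ] / J` as elements annihilated by `J`. -/

section RepAnnihilator

variable {R : Type u} [CommRing R] {Γ : Type u} [Group Γ]

theorem rep_hom_asAlgebraHom {V W : Rep.{u} R Γ} (f : V ⟶ W) (a : MonoidAlgebra R Γ) (v : V) :
    f.hom (V.ρ.asAlgebraHom a v) = W.ρ.asAlgebraHom a (f.hom v) :=
  Rep.to_Module_monoidAlgebra_map_aux V.V W.V V.ρ W.ρ f.hom.toLinearMap f.hom.2 a v

/-- The elements of a representation that are annihilated by a left ideal of the group algebra. -/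
def annihilated (J : Ideal (MonoidAlgebra R Γ)) (V : Rep.{u} R Γ) : Submodule R V where
  carrier := {v | ∀ a ∈ J, V.ρ.asAlgebraHom a v = 0}
  add_mem' {v w} hv hw a ha := by rw [map_add, hv a ha, hw a ha, add_zero]
  zero_mem' a _ := map_zero _
  smul_mem' c v hv a ha := by rw [map_smul, hv a ha, smul_zero]

/-- The functor that takes a representation to its elements annihilated by a left ideal. -/
def annihilatedFunctor (J : Ideal (MonoidAlgebra R Γ)) : Rep.{u} R Γ ⥤ ModuleCat.{u} R where
  obj V := ModuleCat.of R (annihilated J V)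
  map {V W} f := ModuleCat.ofHom (f.hom.toLinearMap.restrict (p := annihilated J V)
    (q := annihilated J W) fun v hv a ha =>
      (rep_hom_asAlgebraHom f a v).symm.trans ((congrArg f.hom (hv a ha)).trans (map_zero _)))
  map_id _ := rfl
  map_comp _ _ := rfl

/-- The class of `1` in the representation `R[Γ] / J`. -/
def quotientOne (J : Ideal (MonoidAlgebra R Γ)) :
    Rep.ofModuleMonoidAlgebra.obj (ModuleCat.of (MonoidAlgebra R Γ) (MonoidAlgebra R Γ ⧸ J)) :=
  (Submodule.Quotient.mk 1 : MonoidAlgebra R Γ ⧸ J)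

theorem asAlgebraHom_quotientOne (J : Ideal (MonoidAlgebra R Γ)) (a : MonoidAlgebra R Γ) :
    (Rep.ofModuleMonoidAlgebra.obj (ModuleCat.of (MonoidAlgebra R Γ)
      (MonoidAlgebra R Γ ⧸ J))).ρ.asAlgebraHom a (quotientOne J) =
      (Submodule.Quotient.mk a : MonoidAlgebra R Γ ⧸ J) := by
  refine (Representation.ofModule_asAlgebraHom_apply_apply _ a _).trans ?_
  show a • (Submodule.Quotient.mk 1 : MonoidAlgebra R Γ ⧸ J) = _
  rw [← Submodule.Quotient.mk_smul, smul_eq_mul, mul_one]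

/-- The value of a homomorphism at the class of `1`, as an element annihilated by `J`. -/
def evalQuotientOne (J : Ideal (MonoidAlgebra R Γ)) (V : Rep.{u} R Γ) :
    (Rep.ofModuleMonoidAlgebra.obj (ModuleCat.of (MonoidAlgebra R Γ)
      (MonoidAlgebra R Γ ⧸ J)) ⟶ V) →ₗ[R] annihilated J V where
  toFun f := ⟨f.hom (quotientOne J), fun a ha => by
    rw [← rep_hom_asAlgebraHom, asAlgebraHom_quotientOne,
      (Submodule.Quotient.mk_eq_zero J).2 ha]
    exact map_zero f.hom⟩
  map_add' _ _ := rfl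
  map_smul' _ _ := rfl

theorem evalQuotientOne_bijective (J : Ideal (MonoidAlgebra R Γ)) (V : Rep.{u} R Γ) :
    Function.Bijective (evalQuotientOne J V) := by
  constructor
  · intro f g h
    have h : f.hom (quotientOne J) = g.hom (quotientOne J) := congrArg Subtype.val h
    ext x
    obtain ⟨a, rfl⟩ := Submodule.Quotient.mk_surjective J x
    rw [← asAlgebraHom_quotientOne]
    exact (rep_hom_asAlgebraHom f a _).trans
      ((congrArg _ h).trans (rep_hom_asAlgebraHom g a _).symm)
  · intro v
    let φ : (MonoidAlgebra R Γ ⧸ J) →ₗ[MonoidAlgebra R Γ] V.ρ.asModule :=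
      Submodule.liftQ J (LinearMap.toSpanSingleton (MonoidAlgebra R Γ) V.ρ.asModule
        (V.ρ.asModuleEquiv.symm v.1)) fun a ha => v.2 a ha
    refine ⟨Rep.ofModuleMonoidAlgebra.map (ModuleCat.ofHom φ) ≫ (Rep.unitIso V).inv,
      Subtype.ext ?_⟩
    show V.ρ.asAlgebraHom 1 v.1 = v.1
    rw [map_one]
    rfl

/-- A homomorphism from `R[Γ] / J` to a representation is the same as an element annihilated
by `J`. -/
def coyonedaIsoAnnihilated (J : Ideal (MonoidAlgebra R Γ)) :
    (linearCoyoneda R (Rep.{u} R Γ)).obj (op (Rep.ofModuleMonoidAlgebra.obj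
      (ModuleCat.of (MonoidAlgebra R Γ) (MonoidAlgebra R Γ ⧸ J)))) ≅ annihilatedFunctor J :=
  NatIso.ofComponents (fun V => (LinearEquiv.ofBijective (evalQuotientOne J V)
    (evalQuotientOne_bijective J V)).toModuleIso) fun _ => rfl

end RepAnnihilator

/-! ### Left exactness of `H_q^0`, and descent of invariants to `Y`. -/

section LeftExact

open Limits

variable {R : Type u} [CommRing R] {Y : TopCat.{u}} {X : Type u} [TopologicalSpace X]
  {Γ : Type u} [Group Γ]

/-- Two families of germs in `H^0(X, π^* F)` agree if they agree everywhere. -/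
theorem pullbackSections_ext {π : C(X, Y)} {F : TopCat.Sheaf (ModuleCat.{u} R) Y}
    {v w : pullbackSections π F} (h : ∀ x, v.1 (π x) ⟨x, rfl⟩ = w.1 (π x) ⟨x, rfl⟩) : v = w := by
  refine Subtype.ext (funext fun y => funext fun x => ?_)
  obtain ⟨x, rfl⟩ := x
  exact h x

/-- The map `H^0(X, π^* F) → H^0(X, π^* G)` induced by a morphism of sheaves. -/
abbrev pullbackMap (π : C(X, Y)) {F G : TopCat.Sheaf (ModuleCat.{u} R) Y} (f : F ⟶ G) :
    pullbackSections π F →ₗ[R] pullbackSections π G :=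
  ((pullbackSectionsFunctor R π).map f).hom.toLinearMap

theorem pullbackMap_asAlgebraHom (π : C(X, Y)) {F G : TopCat.Sheaf (ModuleCat.{u} R) Y}
    (f : F ⟶ G) (a : MonoidAlgebra R (deck π)) (v : pullbackSections π F) :
    pullbackMap π f ((pullbackRep π F).asAlgebraHom a v) =
      (pullbackRep π G).asAlgebraHom a (pullbackMap π f v) :=
  rep_hom_asAlgebraHom ((pullbackSectionsFunctor R π).map f) a v

theorem pullbackMap_injective (π : C(X, Y)) {F G : TopCat.Sheaf (ModuleCat.{u} R) Y}
    (f : F ⟶ G) [Mono f] : Function.Injective (pullbackMap π f) := fun _ _ h =>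
  pullbackSections_ext fun x => stalkMap_injective f (π x)
    (congrFun (congrFun (congrArg Subtype.val h) (π x)) ⟨x, rfl⟩)

/-- The germwise preimage is unique, since `S.f` is injective on stalks, and hence continuous along
with `v`. -/
theorem pullbackMap_exact (π : C(X, Y))
    {S : ShortComplex (TopCat.Sheaf (ModuleCat.{u} R) Y)} (hS : S.ShortExact)
    (v : pullbackSections π S.X₂) (hv : pullbackMap π S.g v = 0) :
    ∃ u, pullbackMap π S.f u = v := by
  have := hS.mono_f
  have hex : ∀ (y : Y) (x : {x // π x = y}), ∃ a, stalkMap S.f y a = v.1 y x := fun y x =>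
    stalkMap_exact hS.exact y _ (congrFun (congrFun (congrArg Subtype.val hv) y) x)
  choose u hu using hex
  refine ⟨⟨u, (continuous_toEtale_iff π.continuous u).2 fun x => ?_⟩,
    Subtype.ext (funext fun y => funext fun x => hu y x)⟩
  obtain ⟨U, hU, t, ht⟩ := (continuous_toEtale_iff π.continuous _).1 v.2 x
  obtain ⟨hU', ht'⟩ := ht.self_of_nhds
  obtain ⟨W, hWU, hW, r, hr⟩ := exists_section_of_stalkMap S.f (u (π x) ⟨x, rfl⟩) hU t
    ((hu _ _).trans ht')
  refine ⟨W, hW, r, ?_⟩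
  filter_upwards [ht, (W.isOpen.preimage π.continuous).mem_nhds hW] with z ⟨hzU, hz⟩ hzW
  exact ⟨hzW, hr (π z) hzW _ ((hu _ _).trans hz)⟩

/-- The elements of `H^0(X, π^* F)` that are annihilated by the left ideal `J`, as a functor
of `F`. -/
def annihilatedSections (π : C(X, Y)) (J : Ideal (MonoidAlgebra R (deck π))) :
    TopCat.Sheaf (ModuleCat.{u} R) Y ⥤ ModuleCat.{u} R :=
  pullbackSectionsFunctor R π ⋙ annihilatedFunctor J

instance (π : C(X, Y)) (J : Ideal (MonoidAlgebra R (deck π))) :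
    (annihilatedSections π J).Additive where
  map_add {F G f g} := by
    show (annihilatedFunctor J).map ((pullbackSectionsFunctor R π).map (f + g)) = _
    rw [Functor.map_add]
    rfl

instance (π : C(X, Y)) (J : Ideal (MonoidAlgebra R (deck π))) :
    PreservesFiniteLimits (annihilatedSections π J) := by
  refine ((annihilatedSections π J).preservesFiniteLimits_tfae.out 0 3).1 fun S hS => ?_
  have := hS.mono_f
  have hinj := pullbackMap_injective π S.f
  refine ⟨(ShortComplex.moduleCat_exact_iff _).2 fun v hv => ?_,
    (ModuleCat.mono_iff_injective _).2 fun v w h =>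
      Subtype.ext (hinj (congrArg Subtype.val h))⟩
  obtain ⟨u, hu⟩ := pullbackMap_exact π hS v.1 (congrArg Subtype.val hv)
  -- The preimage `u` is again annihilated by `J`, because the map induced by `S.f` is injective and
  -- commutes with the group algebra.
  refine ⟨⟨u, fun a ha => hinj ?_⟩, Subtype.ext hu⟩
  refine (pullbackMap_asAlgebraHom π S.f a u).trans ?_
  rw [hu]
  exact (v.2 a ha).trans (map_zero _).symm

/-- The functor `H_q^0(Y, C, ·)` as the elements of `H^0(X, π^* F)` annihilated by `J_q`. -/
def sheafH0Iso {C : Type u} (π : C(X, Y)) (ρ : X → C) (q : ℕ) :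
    sheafH0 R π ρ q ≅ annihilatedSections π (idealJ R (deckOver π ρ) q) :=
  Functor.isoWhiskerLeft _ (coyonedaIsoAnnihilated _)

/-- Isomorphic additive functors have isomorphic right derived functors. -/
def rightDerivedIso {T T' : TopCat.Sheaf (ModuleCat.{u} R) Y ⥤ ModuleCat.{u} R} [T.Additive]
    [T'.Additive] (e : T ≅ T') (p : ℕ) : T.rightDerived p ≅ T'.rightDerived p where
  hom := NatTrans.rightDerived e.hom p
  inv := NatTrans.rightDerived e.inv p
  hom_inv_id := by rw [← NatTrans.rightDerived_comp, e.hom_inv_id, NatTrans.rightDerived_id]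
  inv_hom_id := by rw [← NatTrans.rightDerived_comp, e.inv_hom_id, NatTrans.rightDerived_id]

theorem asAlgebraHom_eq_of_invariant {V : Rep.{u} R Γ} {v : V} (hv : ∀ g, V.ρ g v = v)
    (a : MonoidAlgebra R Γ) :
    V.ρ.asAlgebraHom a v = MonoidAlgebra.lift R R Γ (1 : Γ →* R) a • v := by
  induction a using MonoidAlgebra.induction_on with
  | of g => simp [hv]
  | add a b ha hb => rw [map_add, map_add, add_smul, LinearMap.add_apply, ha, hb]
  | smul r a ha => rw [map_smul, map_smul, LinearMap.smul_apply, ha, smul_assoc]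

theorem idealJ_le_augmentationIdeal (S : Subgroup Γ) {q : ℕ} (hq : 1 ≤ q) :
    idealJ R S q ≤ augmentationIdeal R Γ := by
  refine sup_le (Ideal.pow_le_self (by omega)) (Ideal.map_le_iff_le_comap.2 fun a ha => ?_)
  have h : (MonoidAlgebra.lift R R Γ (1 : Γ →* R)).comp
      (MonoidAlgebra.mapDomainAlgHom R R S.subtype) = MonoidAlgebra.lift R R S (1 : S →* R) := by
    ext
    simp
  exact (DFunLike.congr_fun h a).trans ha

/-- The elements `g - 1` lie in `I ⊂ J_1`, which gives one direction. For the other, `J_1 ⊂ I`, and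
`a` acts on an invariant element as the scalar given by its augmentation. -/
theorem mem_annihilated_idealJ_one (S : Subgroup Γ) {V : Rep.{u} R Γ} (v : V) :
    v ∈ annihilated (idealJ R S 1) V ↔ ∀ g, V.ρ g v = v := by
  constructor
  · intro hv g
    have h : MonoidAlgebra.single g (1 : R) - 1 ∈ augmentationIdeal R Γ := by
      simp [augmentationIdeal, RingHom.mem_ker]
    have := hv _ (le_sup_left (a := augmentationIdeal R Γ ^ 1) ((Submodule.pow_one _).ge h))
    rw [map_sub, LinearMap.sub_apply, Representation.asAlgebraHom_single_one, map_one,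
      sub_eq_zero] at this
    exact this
  · intro hv a ha
    rw [asAlgebraHom_eq_of_invariant hv, idealJ_le_augmentationIdeal S le_rfl ha, zero_smul]

/-- A global section of `F`, as an invariant family of germs on `X`. -/
def globalFamily (π : C(X, Y)) (F : TopCat.Sheaf (ModuleCat.{u} R) Y) :
    F.presheaf.obj (op ⊤) →ₗ[R] pullbackSections π F where
  toFun t := ⟨fun y _ => F.presheaf.germ ⊤ y trivial t,
    (continuous_toEtale_iff π.continuous _).2 fun _ =>
      ⟨⊤, trivial, t, .of_forall fun _ => ⟨trivial, rfl⟩⟩⟩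
  map_add' s t := Subtype.ext (funext fun _ => funext fun _ => map_add _ s t)
  map_smul' c t := Subtype.ext (funext fun _ => funext fun _ => map_smul _ c t)

/-- Deck transformations are transitive on fibres, so an invariant family has one germ for each
point of `Y`. Local sections on `X` push down because `π` is open. -/
theorem exists_globalFamily_eq {π : C(X, Y)} (hπ : IsPrincipalCovering π)
    {F : TopCat.Sheaf (ModuleCat.{u} R) Y} (v : pullbackSections π F)
    (hv : ∀ g, pullbackRep π F g v = v) : ∃ t, globalFamily π F t = v := by
  have hconst : ∀ (y : Y) (x x' : {x // π x = y}), v.1 y x = v.1 y x' := by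
    intro y x x'
    obtain ⟨g, hg⟩ := hπ.exists_deck x'.1 x.1 (x'.2.trans x.2.symm)
    have h : v.1 y ⟨g.1⁻¹ x.1, _⟩ = v.1 y x :=
      congrFun (congrFun (congrArg Subtype.val (hv g)) y) x
    rw [← h]
    refine congrArg (v.1 y) (Subtype.ext ?_)
    show g.1.symm x.1 = x'.1
    rw [← hg]
    exact g.1.symm_apply_apply x'.1
  choose σ hσ using hπ.surjective
  have hsec : IsLocallySection F ⊤ fun y => v.1 y ⟨σ y, hσ y⟩ := by
    intro y _
    obtain ⟨U, hU, t, ht⟩ := (continuous_toEtale_iff π.continuous _).1 v.2 (σ y)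
    obtain ⟨W, hW, hWo, hyW⟩ := mem_nhds_iff.1 ht
    have himg : IsOpen (π '' W) := hπ.isLocalHomeomorph.isOpenMap W hWo
    have hle : (⟨π '' W, himg⟩ : Opens Y) ≤ U := by
      rintro _ ⟨z, hz, rfl⟩
      exact (hW hz).1
    refine ⟨⟨π '' W, himg⟩, ⟨σ y, hyW, hσ y⟩, F.presheaf.map (homOfLE hle).op t, ?_⟩
    intro z hz
    have hz' := hz
    obtain ⟨x, hx, rfl⟩ := hz'
    exact ((hconst _ _ ⟨x, rfl⟩).trans (hW hx).2).trans (germ_res hle hz t).symm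
  obtain ⟨t, ht⟩ := hsec.exists_section
  exact ⟨t, pullbackSections_ext fun x => (ht (π x) trivial).trans (hconst _ _ _)⟩

theorem globalFamily_injective {π : C(X, Y)} (hπ : Function.Surjective π)
    (F : TopCat.Sheaf (ModuleCat.{u} R) Y) : Function.Injective (globalFamily π F) := by
  intro s t h
  refine section_ext fun y _ => ?_
  obtain ⟨x, rfl⟩ := hπ y
  exact congrFun (congrFun (congrArg Subtype.val h) (π x)) ⟨x, rfl⟩

/-- The global sections of `F` are the elements of `H^0(X, π^* F)` annihilated by `J_1`. -/
def globalSectionsIso {π : C(X, Y)} (hπ : IsPrincipalCovering π) (S : Subgroup (deck π)) :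
    globalSections R Y ≅ annihilatedSections π (idealJ R S 1) :=
  NatIso.ofComponents (fun F => (LinearEquiv.ofBijective
      ((globalFamily π F).codRestrict (annihilated (idealJ R S 1) (Rep.of (pullbackRep π F)))
        fun t => (mem_annihilated_idealJ_one S _).2 fun g => rfl)
      ⟨fun s t h => globalFamily_injective hπ.surjective F (congrArg Subtype.val h), fun v => by
        obtain ⟨t, ht⟩ := exists_globalFamily_eq hπ v.1 ((mem_annihilated_idealJ_one S _).1 v.2)
        exact ⟨t, Subtype.ext ht⟩⟩).toModuleIso)
    fun {F G} f => by
      ext t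
      refine Subtype.ext (pullbackSections_ext fun x => ?_)
      exact (stalkMap_germ f (U := ⊤) trivial t).symm

end LeftExact

end

end HigherOrder

namespace HigherOrder

noncomputable section

/-! ### Lifting annihilated elements from `J_1` to `J_q`. -/

section Graded

variable {R : Type u} [CommRing R] {Γ : Type u} [Group Γ]

theorem idealJ_succ_le (S : Subgroup Γ) (q : ℕ) :
    idealJ R S (q + 1) ≤ idealJ R S q :=
  sup_le_sup_right (Ideal.pow_le_pow_right (Nat.le_succ q)) _

/-- This says that `Γ` acts trivially on `J_q / J_{q+1}`. The summand `A I_Σ` absorbs left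
multiplication. -/
theorem mul_mem_idealJ_succ (S : Subgroup Γ) {q : ℕ} (hq : 1 ≤ q) {a j : MonoidAlgebra R Γ}
    (ha : a ∈ augmentationIdeal R Γ) (hj : j ∈ idealJ R S q) : a * j ∈ idealJ R S (q + 1) := by
  obtain ⟨x, hx, y, hy, rfl⟩ := Submodule.mem_sup.1 hj
  rw [mul_add]
  refine Submodule.add_mem_sup ?_ (Ideal.mul_mem_left _ a hy)
  rw [Submodule.pow_succ' _ (by omega)]
  exact Ideal.mul_mem_mul ha hx

/-- Baer's condition: a representation `V` satisfies it if every homomorphism to `V` from a left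
ideal of the group algebra extends to the group algebra. -/
def IsBaer (V : Rep.{u} R Γ) : Prop :=
  ∀ (K : Ideal (MonoidAlgebra R Γ)) (φ : K.restrictScalars R →ₗ[R] V),
    (∀ (a : MonoidAlgebra R Γ) (k : K.restrictScalars R),
      φ ⟨a * k.1, K.mul_mem_left a k.2⟩ = V.ρ.asAlgebraHom a (φ k)) →
        ∃ w : V, ∀ k : K.restrictScalars R, φ k = V.ρ.asAlgebraHom k.1 w

/-- If `J_{q+1}` kills `w`, then `j ↦ j w` is a map from `J_q / J_{q+1}` to the invariants of `W`.
Freeness lifts it to the invariants of `V`, and Baer's condition writes the lift as `j ↦ j v'`. Then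
`J_q` kills `w - f v'`, and induction applies. -/
theorem exists_annihilated_idealJ_of_isBaer (S : Subgroup Γ) {V W : Rep.{u} R Γ} (f : V ⟶ W)
    (hV : IsBaer V)
    (h₁ : ∀ w ∈ annihilated (idealJ R S 1) W, ∃ v ∈ annihilated (idealJ R S 1) V, f.hom v = w)
    (q : ℕ) (hq : 1 ≤ q) (hfree : ∀ k, 1 ≤ k → k < q → Module.Free R (gradedJ R S k)) :
    ∀ w ∈ annihilated (idealJ R S q) W, ∃ v ∈ annihilated (idealJ R S q) V, f.hom v = w := by
  induction q, hq using Nat.le_induction with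
  | base => exact h₁
  | succ q hq ih =>
    intro w hw
    have := hfree q hq (Nat.lt_succ_self q)
    let b := Module.Free.chooseBasis R (gradedJ R S q)
    let mk : (idealJ R S q).restrictScalars R →ₗ[R] gradedJ R S q := Submodule.mkQ _
    have hmk : ∀ j : (idealJ R S q).restrictScalars R, j.1 ∈ idealJ R S (q + 1) → mk j = 0 :=
      fun j hj => (Submodule.Quotient.mk_eq_zero _).2 hj
    choose j hj using fun i => Submodule.mkQ_surjective _ (b i)
    have hjw : ∀ i, W.ρ.asAlgebraHom (j i).1 w ∈ annihilated (idealJ R S 1) W := by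
      intro i a ha
      rw [← Module.End.mul_apply, ← map_mul]
      exact hw _ (mul_mem_idealJ_succ S hq (idealJ_le_augmentationIdeal S le_rfl ha) (j i).2)
    choose v hv hfv using fun i => h₁ _ (hjw i)
    let c : gradedJ R S q →ₗ[R] V := b.constr R v
    have hc : ∀ x, c x ∈ annihilated (idealJ R S 1) V := by
      have : (⊤ : Submodule R (gradedJ R S q)) ≤ (annihilated (idealJ R S 1) V).comap c := by
        rw [← b.span_eq, Submodule.span_le]
        rintro _ ⟨i, rfl⟩
        show c (b i) ∈ annihilated (idealJ R S 1) V
        rw [b.constr_basis]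
        exact hv i
      exact fun x => this trivial
    -- The map `c ∘ₗ mk` is `A`-linear because `a` acts through its augmentation `ε` both on `J_q /
    -- J_{q+1}` and on the invariants in which `c` takes its values.
    obtain ⟨v', hv'⟩ := hV (idealJ R S q) (c ∘ₗ mk) fun a k => by
      set ε := MonoidAlgebra.lift R R Γ (1 : Γ →* R) a with hε
      have h : mk ⟨a * k.1, (idealJ R S q).mul_mem_left a k.2⟩ = ε • mk k := by
        rw [← map_smul, ← sub_eq_zero, ← map_sub]
        refine hmk _ ?_
        have : a * k.1 - ε • k.1 = (a - algebraMap R _ ε) * k.1 := by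
          rw [sub_mul, Algebra.smul_def]
        show a * k.1 - ε • k.1 ∈ idealJ R S (q + 1)
        rw [this]
        refine mul_mem_idealJ_succ S hq ?_ k.2
        show MonoidAlgebra.lift R R Γ (1 : Γ →* R) (a - algebraMap R _ ε) = 0
        rw [map_sub, AlgHom.commutes]
        exact sub_self ε
      show c (mk ⟨a * k.1, (idealJ R S q).mul_mem_left a k.2⟩) = V.ρ.asAlgebraHom a (c (mk k))
      rw [h, map_smul, asAlgebraHom_eq_of_invariant
        ((mem_annihilated_idealJ_one S _).1 (hc _)) a]
    have hv' : ∀ k ∈ idealJ R S q, ∀ hk, c (mk ⟨k, hk⟩) = V.ρ.asAlgebraHom k v' :=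
      fun k _ hk => hv' ⟨k, hk⟩
    let d : gradedJ R S q →ₗ[R] W := Submodule.liftQ _
      ((LinearMap.applyₗ w ∘ₗ W.ρ.asAlgebraHom.toLinearMap) ∘ₗ
        ((idealJ R S q).restrictScalars R).subtype) fun x hx => hw _ hx
    have hd : ∀ k, d (mk k) = W.ρ.asAlgebraHom k.1 w := fun k => rfl
    have hcd : f.hom.toLinearMap ∘ₗ c = d := b.ext fun i => by
      show f.hom (c (b i)) = d (b i)
      rw [b.constr_basis, hfv, ← hj i]
      rfl
    obtain ⟨u, hu, hfu⟩ := ih (fun k hk hkq => hfree k hk (hkq.trans (Nat.lt_succ_self q)))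
      (w - f.hom v') fun k hk => by
        rw [map_sub, ← rep_hom_asAlgebraHom, ← hv' k hk hk, ← hd ⟨k, hk⟩, ← hcd]
        exact sub_self _
    refine ⟨v' + u, fun k hk => ?_, ?_⟩
    · have hk' := idealJ_succ_le S q hk
      rw [map_add, hu k hk', ← hv' k hk' hk', hmk _ hk, map_zero, add_zero]
    · rw [map_add, hfu, add_sub_cancel]

end Graded

/-! ### Injective sheaves satisfy Baer's condition. -/

section Baer

variable {R : Type u} [CommRing R] {Y : TopCat.{u}} {X : Type u} [TopologicalSpace X]
  {π : C(X, Y)} {F : TopCat.Sheaf (ModuleCat.{u} R) Y} {K : Ideal (MonoidAlgebra R (deck π))}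

/-- The functions from `X` to the group algebra whose restrictions to the inverse image of `U` are
locally constant, equivariant, and take values in the left ideal `K`. -/
def equivariantOn (K : Ideal (MonoidAlgebra R (deck π))) (U : Opens Y) :
    Submodule R (X → MonoidAlgebra R (deck π)) where
  carrier := {f | ∀ x, π x ∈ U → f x ∈ K ∧
    (∀ g : deck π, f (g.1 x) = MonoidAlgebra.single g 1 * f x) ∧ ∀ᶠ x' in nhds x, f x' = f x}
  add_mem' {f f'} hf hf' x hx := by
    obtain ⟨h₁, h₂, h₃⟩ := hf x hx
    obtain ⟨h₁', h₂', h₃'⟩ := hf' x hx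
    refine ⟨K.add_mem h₁ h₁', fun g => ?_, ?_⟩
    · rw [Pi.add_apply, Pi.add_apply, h₂, h₂', mul_add]
    · filter_upwards [h₃, h₃'] with z hz hz'
      rw [Pi.add_apply, Pi.add_apply, hz, hz']
  zero_mem' x _ := ⟨K.zero_mem, fun _ => (mul_zero _).symm, .of_forall fun _ => rfl⟩
  smul_mem' c f hf x hx := by
    obtain ⟨h₁, h₂, h₃⟩ := hf x hx
    refine ⟨(K.restrictScalars R).smul_mem c h₁, fun g => ?_, ?_⟩
    · rw [Pi.smul_apply, Pi.smul_apply, h₂, mul_smul_comm]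
    · filter_upwards [h₃] with z hz
      rw [Pi.smul_apply, Pi.smul_apply, hz]

theorem apply_single_mul {φ : K.restrictScalars R →ₗ[R] pullbackSections π F}
    (hφ : ∀ (a : MonoidAlgebra R (deck π)) (k : K.restrictScalars R),
      φ ⟨a * k.1, K.mul_mem_left a k.2⟩ = (pullbackRep π F).asAlgebraHom a (φ k))
    (k : K.restrictScalars R) {y : Y} (x x' : {x // π x = y}) (g : deck π) (hg : g.1 x.1 = x'.1)
    (h : MonoidAlgebra.single g 1 * k.1 ∈ K) :
    (φ ⟨MonoidAlgebra.single g 1 * k.1, h⟩).1 y x' = (φ k).1 y x := by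
  rw [hφ, Representation.asAlgebraHom_single_one]
  refine congrArg ((φ k).1 y) (Subtype.ext ?_)
  show g.1.symm x'.1 = x.1
  rw [← hg]
  exact g.1.symm_apply_apply x.1

/-- The germ `φ (f x)` at `x` is the same along a fibre: `φ (f (g x)) = φ (g f(x)) = g φ (f x)`,
whose germ at `g x` is that of `φ (f x)` at `x`. It varies continuously since `f` is locally
constant, so it descends to `U`. -/
theorem exists_section_of_equivariantOn (hπ : IsPrincipalCovering π)
    {φ : K.restrictScalars R →ₗ[R] pullbackSections π F}
    (hφ : ∀ (a : MonoidAlgebra R (deck π)) (k : K.restrictScalars R),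
      φ ⟨a * k.1, K.mul_mem_left a k.2⟩ = (pullbackRep π F).asAlgebraHom a (φ k))
    {U : Opens Y} {f : X → MonoidAlgebra R (deck π)} (hf : f ∈ equivariantOn K U) :
    ∃ t : F.presheaf.obj (op U), ∀ (y : Y) (hy : y ∈ U) (x : {x // π x = y}) (hx : f x.1 ∈ K),
      F.presheaf.germ U y hy t = (φ ⟨f x.1, hx⟩).1 y x := by
  choose σ hσ using hπ.surjective
  have hK : ∀ {y} (_ : y ∈ U) (x : {x // π x = y}), f x.1 ∈ K := fun {y} hy x =>
    (hf x.1 (by rwa [x.2])).1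
  have hconst : ∀ (y : Y) (_ : y ∈ U) (x x' : {x // π x = y}) (hx : f x.1 ∈ K) (hx' : f x'.1 ∈ K),
      (φ ⟨f x'.1, hx'⟩).1 y x' = (φ ⟨f x.1, hx⟩).1 y x := by
    intro y hy x x' hx hx'
    obtain ⟨g, hg⟩ := hπ.exists_deck x.1 x'.1 (x.2.trans x'.2.symm)
    have h : f x'.1 = MonoidAlgebra.single g 1 * f x.1 := by
      rw [← hg]
      exact (hf x.1 (by rwa [x.2])).2.1 g
    rw [← apply_single_mul hφ ⟨f x.1, hx⟩ x x' g hg (by rwa [← h])]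
    simp only [h]
  classical
  let s : ∀ y, F.presheaf.stalk y := fun y =>
    if hy : y ∈ U then (φ ⟨f (σ y), hK hy ⟨σ y, hσ y⟩⟩).1 y ⟨σ y, hσ y⟩ else 0
  have hs : ∀ (y : Y) (_ : y ∈ U) (x : {x // π x = y}) (hx : f x.1 ∈ K),
      s y = (φ ⟨f x.1, hx⟩).1 y x := by
    intro y hy x hx
    simp only [s, dif_pos hy]
    exact hconst y hy x ⟨σ y, hσ y⟩ hx _
  have hsec : IsLocallySection F U s := by
    intro y hy
    have hx : π (σ y) ∈ U := by rwa [hσ]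
    obtain ⟨hxK, -, hloc⟩ := hf (σ y) hx
    obtain ⟨V, hV, t, ht⟩ :=
      (continuous_toEtale_iff π.continuous _).1 (φ ⟨f (σ y), hxK⟩).2 (σ y)
    obtain ⟨W, hW, hWo, hyW⟩ := mem_nhds_iff.1 (Filter.inter_mem (Filter.inter_mem ht hloc)
      ((U.isOpen.preimage π.continuous).mem_nhds hx))
    have himg : IsOpen (π '' W) := hπ.isLocalHomeomorph.isOpenMap W hWo
    have hle : (⟨π '' W, himg⟩ : Opens Y) ≤ V := by
      rintro _ ⟨z, hz, rfl⟩
      exact (hW hz).1.1.1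
    refine ⟨⟨π '' W, himg⟩, ⟨σ y, hyW, hσ y⟩, F.presheaf.map (homOfLE hle).op t, ?_⟩
    intro z hz
    have hz' := hz
    obtain ⟨x, hxW, rfl⟩ := hz'
    obtain ⟨⟨⟨hxV, h₁⟩, h₂⟩, h₃⟩ := hW hxW
    have h₂ : f x = f (σ y) := h₂
    refine ((hs (π x) h₃ ⟨x, rfl⟩ (by rwa [h₂])).trans ?_).trans (germ_res hle hz t).symm
    simp only [h₂]
    exact h₁
  obtain ⟨t, ht⟩ := hsec.exists_section
  exact ⟨t, fun y hy x hx => (ht y hy).trans (hs y hy x hx)⟩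

/-- The equivariant functions form a subpresheaf of the constant presheaf of all functions `X → A`,
since the conditions are imposed only over `U`. The morphism `f ↦ φ (f x)` to `F` extends to the
constant presheaf, and `Ψ` is the extension over `Y`. -/
theorem exists_linearMap_of_injective (hπ : IsPrincipalCovering π) (hF : Injective F)
    {φ : K.restrictScalars R →ₗ[R] pullbackSections π F}
    (hφ : ∀ (a : MonoidAlgebra R (deck π)) (k : K.restrictScalars R),
      φ ⟨a * k.1, K.mul_mem_left a k.2⟩ = (pullbackRep π F).asAlgebraHom a (φ k)) :
    ∃ Ψ : (X → MonoidAlgebra R (deck π)) →ₗ[R] F.presheaf.obj (op ⊤),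
      ∀ (U : Opens Y) (f) (_ : f ∈ equivariantOn K U) (y : Y) (_ : y ∈ U) (x : {x // π x = y})
        (hx : f x.1 ∈ K), F.presheaf.germ ⊤ y trivial (Ψ f) = (φ ⟨f x.1, hx⟩).1 y x := by
  let Q : (Opens Y)ᵒᵖ ⥤ ModuleCat.{u} R :=
    (Functor.const _).obj (ModuleCat.of R (X → MonoidAlgebra R (deck π)))
  let N : ∀ U, Submodule R (Q.obj U) := fun U => equivariantOn K (unop U)
  have hN : ∀ {U V} (i : U ⟶ V) (f : Q.obj U), f ∈ N U → Q.map i f ∈ N V :=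
    fun i f hf x hx => hf x (i.unop.le hx)
  choose e he using fun (U : Opens Y) (f : equivariantOn K U) =>
    exists_section_of_equivariantOn hπ hφ f.2
  have hu : ∀ (U : Opens Y) (f : equivariantOn K U) (t : F.presheaf.obj (op U)),
      (∀ (y : Y) (hy : y ∈ U) (x : {x // π x = y}) (hx : f.1 x.1 ∈ K),
        F.presheaf.germ U y hy t = (φ ⟨f.1 x.1, hx⟩).1 y x) → t = e U f := by
    intro U f t ht
    refine section_ext fun y hy => ?_
    obtain ⟨x, rfl⟩ := hπ.surjective y
    have hx : f.1 x ∈ K := (f.2 x hy).1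
    rw [ht _ hy ⟨x, rfl⟩ hx, he U f _ hy ⟨x, rfl⟩ hx]
  let θ : subpresheaf Q N hN ⟶ F.obj :=
    { app := fun U => ModuleCat.ofHom
        { toFun := fun f : equivariantOn K (unop U) => e (unop U) f
          map_add' := fun f f' => by
            refine (hu _ _ _ fun y hy x hx => ?_).symm
            have hf := (f.2 x.1 (by rwa [x.2])).1
            have hf' := (f'.2 x.1 (by rwa [x.2])).1
            refine (map_add _ _ _).trans ?_
            exact (congrArg₂ (· + ·) (he _ f y hy x hf) (he _ f' y hy x hf')).trans
              (congrFun (congrFun (congrArg Subtype.val (map_add φ ⟨_, hf⟩ ⟨_, hf'⟩)) y) x).symm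
          map_smul' := fun c f => by
            refine (hu _ _ _ fun y hy x hx => ?_).symm
            have hf := (f.2 x.1 (by rwa [x.2])).1
            refine (map_smul _ _ _).trans ?_
            exact (congrArg (c • ·) (he _ f y hy x hf)).trans
              (congrFun (congrFun (congrArg Subtype.val (map_smul φ c ⟨_, hf⟩)) y) x).symm }
      naturality := fun U V i => by
        ext f
        refine (hu (unop V) _ _ fun y hy x hx => ?_).symm
        exact (F.presheaf.germ_res_apply i.unop y hy _).trans
          (he (unop U) f y (i.unop.le hy) x hx) }
  obtain ⟨ψ, hψ⟩ := exists_extension hF Q N hN θ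
  refine ⟨(ψ.app (op ⊤)).hom, fun U f hf y hy x hx => ?_⟩
  have h₁ := ConcreteCategory.congr_hom (ψ.naturality (homOfLE (le_top : U ≤ ⊤)).op) f
  have h₂ := hψ (op U) ⟨f, hf⟩
  rw [← he U ⟨f, hf⟩ y hy x hx]
  refine Eq.trans ?_ (congrArg _ h₂)
  refine Eq.trans ?_ (congrArg _ h₁.symm)
  exact (germ_res le_top hy _).symm

/-- The function that is `γ` on the translate of `W` by the deck transformation `γ`. -/
def translateIndex (R : Type u) [CommRing R] (π : X → Y) (W : Set X) (x : X) :
    MonoidAlgebra R (deck π) :=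
  open Classical in
  if h : ∃ g : deck π, g.1.symm x ∈ W then MonoidAlgebra.single h.choose 1 else 0

/-- Since `π` is injective on `W` and the action is free, the translates of `W` are disjoint, and
the chosen `γ` is the only one possible. -/
theorem translateIndex_apply (hπ : IsPrincipalCovering π) {W : Set X} (hW : Set.InjOn π W)
    (g : deck π) {x : X} (hx : x ∈ W) :
    translateIndex R π W (g.1 x) = MonoidAlgebra.single g 1 := by
  have h : ∃ g' : deck π, g'.1.symm (g.1 x) ∈ W := ⟨g, by rwa [g.1.symm_apply_apply]⟩
  rw [translateIndex, dif_pos h]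
  congr 1
  have hx' := h.choose_spec
  refine hπ.eq_of_apply_eq (x := x) ?_
  have : h.choose.1.symm (g.1 x) = x := hW hx' hx (((h.choose⁻¹).2 _).trans (g.2 x))
  exact (congrArg h.choose.1 this).symm.trans (h.choose.1.apply_symm_apply _)

/-- Let `δ_W` be the function `translateIndex R π W`. The representing element has at `x` the germ
of `Ψ δ_W` for a small `W` around `x`. Acting on it by `k` replaces `δ_W` by `δ_W k`, and for `k ∈
K` this function is equivariant with values in `K`, where `Ψ` is given by `φ`. -/
theorem isBaer_of_injective (hπ : IsPrincipalCovering π) (hF : Injective F) :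
    IsBaer (Rep.of (pullbackRep π F)) := by
  intro K φ hφ
  obtain ⟨Ψ, hΨ⟩ := exists_linearMap_of_injective (K := K) hπ hF hφ
  choose W hWo hxW hWinj using hπ.exists_injOn
  -- `Ψ` is local: if `f` and `f'` agree on all translates of `Z`, then `f - f'` vanishes over `π ''
  -- Z`. So it is equivariant there, and the germs of its image are those of `φ 0 = 0`.
  have hcongr : ∀ (f f' : X → MonoidAlgebra R (deck π)) (Z : Set X) (_ : IsOpen Z),
      (∀ x ∈ Z, ∀ g : deck π, f (g.1 x) = f' (g.1 x)) → ∀ x ∈ Z,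
        F.presheaf.germ ⊤ (π x) trivial (Ψ f) = F.presheaf.germ ⊤ (π x) trivial (Ψ f') := by
    intro f f' Z hZ h x hx
    have himg : IsOpen (π '' Z) := hπ.isLocalHomeomorph.isOpenMap Z hZ
    have hzero : ∀ z, π z ∈ π '' Z → (f - f') z = 0 := by
      rintro z ⟨z', hz', e⟩
      obtain ⟨g, rfl⟩ := hπ.exists_deck z' z e
      rw [Pi.sub_apply, h z' hz', sub_self]
    have hmem : f - f' ∈ equivariantOn K ⟨π '' Z, himg⟩ := by
      intro z hz
      refine ⟨by rw [hzero z hz]; exact K.zero_mem, fun g => ?_, ?_⟩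
      · rw [hzero z hz, mul_zero, hzero _ (by rwa [g.2 z])]
      · filter_upwards [(himg.preimage π.continuous).mem_nhds hz] with z' hz'
        rw [hzero z hz, hzero z' hz']
    have h0 : (f - f') x ∈ K := by rw [hzero x ⟨x, hx, rfl⟩]; exact K.zero_mem
    have := hΨ _ _ hmem (π x) ⟨x, hx, rfl⟩ ⟨x, rfl⟩ h0
    have h1 : (⟨(f - f') x, h0⟩ : K.restrictScalars R) = 0 :=
      Subtype.ext (hzero x ⟨x, hx, rfl⟩)
    rw [h1, map_zero, map_sub, map_sub] at this
    exact sub_eq_zero.1 this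
  let w : GermFamily π F := fun y x => F.presheaf.germ ⊤ y trivial (Ψ (translateIndex R π (W x.1)))
  have hw : w ∈ pullbackSections π F := by
    refine (continuous_toEtale_iff π.continuous _).2 fun x =>
      ⟨⊤, trivial, Ψ (translateIndex R π (W x)), ?_⟩
    filter_upwards [(hWo x).mem_nhds (hxW x)] with x' hx'
    refine ⟨trivial, hcongr _ _ (W x' ∩ W x) ((hWo x').inter (hWo x)) ?_ x' ⟨hxW x', hx'⟩⟩
    intro z hz g
    rw [translateIndex_apply hπ (hWinj x') g hz.1, translateIndex_apply hπ (hWinj x) g hz.2]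
  have hact : ∀ (k : MonoidAlgebra R (deck π)) (x : X),
      ((pullbackRep π F).asAlgebraHom k ⟨w, hw⟩).1 (π x) ⟨x, rfl⟩ =
        F.presheaf.germ ⊤ (π x) trivial (Ψ fun z => translateIndex R π (W x) z * k) := by
    intro k x
    induction k using MonoidAlgebra.induction_on with
    | of g =>
      rw [MonoidAlgebra.of_apply, Representation.asAlgebraHom_single_one]
      -- On this set `z = g z'` with `z'` in the neighbourhood chosen at `g⁻¹ x`. There both
      -- functions take the value `g' g` at `g' z`.
      refine hcongr _ _ (W x ∩ g.1.symm ⁻¹' W (g.1.symm x))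
        ((hWo x).inter ((hWo _).preimage g.1.symm.continuous)) ?_ x ⟨hxW x, hxW (g.1.symm x)⟩
      intro z hz g'
      rw [translateIndex_apply hπ (hWinj x) g' hz.1, MonoidAlgebra.single_mul_single, one_mul]
      have := translateIndex_apply (R := R) hπ (hWinj (g.1.symm x)) (g' * g) hz.2
      rw [← this]
      refine congrArg (translateIndex R π _) ?_
      exact congrArg g'.1 (g.1.apply_symm_apply z).symm
    | add a b ha hb =>
      have : (fun z => translateIndex R π (W x) z * (a + b)) =
          (fun z => translateIndex R π (W x) z * a) + fun z => translateIndex R π (W x) z * b :=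
        funext fun z => mul_add _ _ _
      rw [this, map_add Ψ, map_add (pullbackRep π F).asAlgebraHom]
      exact (congrArg₂ (· + ·) ha hb).trans (map_add _ _ _).symm
    | smul r a ha =>
      have : (fun z => translateIndex R π (W x) z * (r • a)) =
          r • fun z => translateIndex R π (W x) z * a :=
        funext fun z => mul_smul_comm _ _ _
      rw [this, map_smul Ψ, map_smul (pullbackRep π F).asAlgebraHom]
      exact (congrArg (r • ·) ha).trans (map_smul _ _ _).symm
  refine ⟨⟨w, hw⟩, fun k => pullbackSections_ext fun x => ?_⟩
  refine Eq.trans ?_ (hact k.1 x).symm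
  have himg : IsOpen (π '' W x) := hπ.isLocalHomeomorph.isOpenMap _ (hWo x)
  have hx1 : translateIndex R π (W x) x = 1 := translateIndex_apply hπ (hWinj x) 1 (hxW x)
  have hmem : (fun z => translateIndex R π (W x) z * k.1) ∈
      equivariantOn K ⟨π '' W x, himg⟩ := by
    rintro z ⟨z', hz', e⟩
    obtain ⟨g, rfl⟩ := hπ.exists_deck z' z e
    show translateIndex R π (W x) (g.1 z') * k.1 ∈ K ∧
      (∀ g' : deck π, translateIndex R π (W x) (g'.1 (g.1 z')) * k.1 =
        MonoidAlgebra.single g' 1 * (translateIndex R π (W x) (g.1 z') * k.1)) ∧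
      ∀ᶠ u in nhds (g.1 z'), translateIndex R π (W x) u * k.1 =
        translateIndex R π (W x) (g.1 z') * k.1
    rw [translateIndex_apply hπ (hWinj x) g hz']
    refine ⟨K.mul_mem_left _ k.2, fun g' => ?_, ?_⟩
    · have := translateIndex_apply (R := R) hπ (hWinj x) (g' * g) hz'
      have h : g'.1 (g.1 z') = (g' * g).1 z' := rfl
      rw [h, this, ← mul_assoc, MonoidAlgebra.single_mul_single, one_mul]
    · have hopen : IsOpen (g.1.symm ⁻¹' W x) := (hWo x).preimage g.1.symm.continuous
      filter_upwards [hopen.mem_nhds (show g.1.symm (g.1 z') ∈ W x by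
        rwa [g.1.symm_apply_apply])] with u hu
      have := translateIndex_apply (R := R) hπ (hWinj x) g hu
      rw [g.1.apply_symm_apply] at this
      rw [this]
  have hval : translateIndex R π (W x) x * k.1 = k.1 := by rw [hx1, one_mul]
  have := hΨ _ _ hmem (π x) ⟨x, hxW x, rfl⟩ ⟨x, rfl⟩ (by rw [hval]; exact k.2)
  refine Eq.trans ?_ this.symm
  simp only [hval]

/-- Acyclicity for the global sections functor implies acyclicity for higher order cohomology. -/
theorem acyclic_annihilatedSections (hπ : IsPrincipalCovering π) (S : Subgroup (deck π)) {q : ℕ}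
    (hq : 1 ≤ q) (hfree : ∀ k, 1 ≤ k → k < q → Module.Free R (gradedJ R S k))
    (hF : Acyclic (annihilatedSections π (idealJ R S 1)) F) :
    Acyclic (annihilatedSections π (idealJ R S q)) F := by
  refine acyclic_of_class _ (Acyclic (annihilatedSections π (idealJ R S 1))) (fun A hA => ?_) F hF
  have hS := shortExact_cokernel (Injective.ι A)
  refine ⟨_, hS, rfl, fun p => ?_, fun p => ?_, ?_⟩
  · exact Functor.isZero_rightDerived_obj_injective_succ _ _ _
  · exact (hA (p + 1)).of_iso (rightDerived_shift _ hS
      (fun _ => Functor.isZero_rightDerived_obj_injective_succ _ _ _) p).some.symm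
  -- Acyclicity of `A` gives the lifting for `J_1`; Baer's condition for the injective sheaf carries
  -- it to `J_q`.
  · intro w
    obtain ⟨v, hv, e⟩ := exists_annihilated_idealJ_of_isBaer S
      ((pullbackSectionsFunctor R π).map (Limits.cokernel.π (Injective.ι A)))
      (isBaer_of_injective hπ inferInstance) (fun w hw => by
        obtain ⟨v, hv⟩ := map_g_surjective_of_isZero (annihilatedSections π (idealJ R S 1)) hS
          (hA 0) ⟨w, hw⟩
        exact ⟨v.1, v.2, congrArg Subtype.val hv⟩) q hq hfree w.1 w.2
    exact ⟨⟨v, hv⟩, Subtype.ext e⟩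

end Baer

end

end HigherOrder

namespace HigherOrder

noncomputable section

/-! ### Families of germs that are sections near a point. -/

section SectionAt

variable {R : Type u} [CommRing R] {Y : TopCat.{u}} {F G : TopCat.Sheaf (ModuleCat.{u} R) Y}

/-- A family of germs that is given near `y` by a section of the sheaf. -/
def IsSectionAt (F : TopCat.Sheaf (ModuleCat.{u} R) Y) (s : ∀ y : Y, F.presheaf.stalk y)
    (y : Y) : Prop :=
  ∃ (V : Opens Y) (_ : y ∈ V) (t : F.presheaf.obj (op V)),
    ∀ (z : Y) (hz : z ∈ V), s z = F.presheaf.germ V z hz t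

namespace IsSectionAt

variable {s s' : ∀ y : Y, F.presheaf.stalk y} {y : Y}

theorem zero (F : TopCat.Sheaf (ModuleCat.{u} R) Y) (y : Y) : IsSectionAt F (fun _ => 0) y :=
  ⟨⊤, trivial, 0, fun _ _ => (map_zero _).symm⟩

theorem congr (h : IsSectionAt F s y) (e : ∀ᶠ z in nhds y, s' z = s z) : IsSectionAt F s' y := by
  obtain ⟨V, hV, t, ht⟩ := h
  obtain ⟨W, hW, hWo, hyW⟩ := mem_nhds_iff.1 e
  have hle : V ⊓ ⟨W, hWo⟩ ≤ V := inf_le_left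
  refine ⟨V ⊓ ⟨W, hWo⟩, ⟨hV, hyW⟩, F.presheaf.map (homOfLE hle).op t, fun z hz => ?_⟩
  rw [germ_res]
  exact (hW hz.2).trans (ht z hz.1)

theorem exists_nhds (h : IsSectionAt F s y) (h' : IsSectionAt F s' y) :
    ∃ (V : Opens Y) (_ : y ∈ V) (t t' : F.presheaf.obj (op V)), ∀ (z : Y) (hz : z ∈ V),
      s z = F.presheaf.germ V z hz t ∧ s' z = F.presheaf.germ V z hz t' := by
  obtain ⟨V, hV, t, ht⟩ := h
  obtain ⟨V', hV', t', ht'⟩ := h'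
  have hle : V ⊓ V' ≤ V := inf_le_left
  have hle' : V ⊓ V' ≤ V' := inf_le_right
  refine ⟨V ⊓ V', ⟨hV, hV'⟩, F.presheaf.map (homOfLE hle).op t,
    F.presheaf.map (homOfLE hle').op t', fun z hz => ?_⟩
  rw [germ_res, germ_res]
  exact ⟨ht z hz.1, ht' z hz.2⟩

theorem add (h : IsSectionAt F s y) (h' : IsSectionAt F s' y) :
    IsSectionAt F (fun z => s z + s' z) y := by
  obtain ⟨V, hV, t, t', e⟩ := exists_nhds h h'
  exact ⟨V, hV, t + t', fun z hz =>
    (congrArg₂ (· + ·) (e z hz).1 (e z hz).2).trans (map_add _ _ _).symm⟩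

theorem sub (h : IsSectionAt F s y) (h' : IsSectionAt F s' y) :
    IsSectionAt F (fun z => s z - s' z) y := by
  obtain ⟨V, hV, t, t', e⟩ := exists_nhds h h'
  exact ⟨V, hV, t - t', fun z hz =>
    (congrArg₂ (· - ·) (e z hz).1 (e z hz).2).trans (map_sub _ _ _).symm⟩

theorem sum {ι : Type*} (T : Finset ι) {s : ι → ∀ y : Y, F.presheaf.stalk y}
    (h : ∀ i ∈ T, IsSectionAt F (s i) y) : IsSectionAt F (fun z => ∑ i ∈ T, s i z) y := by
  classical
  induction T using Finset.induction_on with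
  | empty => simpa using zero F y
  | insert i T hi ih =>
    simp only [Finset.sum_insert hi]
    exact add (h i (Finset.mem_insert_self _ _)) (ih fun j hj => h j (Finset.mem_insert_of_mem hj))

theorem map (h : IsSectionAt F s y) (f : F ⟶ G) :
    IsSectionAt G (fun z => stalkMap f z (s z)) y := by
  obtain ⟨V, hV, t, ht⟩ := h
  exact ⟨V, hV, f.hom.app (op V) t, fun z hz =>
    (congrArg (stalkMap f z) (ht z hz)).trans (stalkMap_germ f hz t)⟩

theorem of_map {f : F ⟶ G} [Mono f] (h : IsSectionAt G (fun z => stalkMap f z (s z)) y) :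
    IsSectionAt F s y := by
  obtain ⟨V, hV, t, ht⟩ := h
  obtain ⟨W, hWV, hW, r, hr⟩ := exists_section_of_stalkMap f (s y) hV t (ht y hV)
  exact ⟨W, hW, r, fun z hz => hr z hz _ (ht z (hWV hz))⟩

end IsSectionAt

end SectionAt

/-! ### The Godement sheaf and its endomorphisms. -/

section Godement

variable {R : Type u} [CommRing R] {Y : TopCat.{u}}

/-- The Godement sheaf of `F`: the sheaf of not necessarily continuous families of germs. -/
def godement (F : TopCat.Sheaf (ModuleCat.{u} R) Y) : TopCat.Sheaf (ModuleCat.{u} R) Y :=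
  ⟨{ obj := fun U => ModuleCat.of R (∀ y : (unop U : Opens Y), F.presheaf.stalk y.1)
     map := fun i => ModuleCat.ofHom
      { toFun := fun s y => s ⟨y.1, i.unop.le y.2⟩
        map_add' := fun _ _ => rfl
        map_smul' := fun _ _ => rfl }
     map_id := fun _ => rfl
     map_comp := fun _ _ => rfl },
    (TopCat.Presheaf.isSheaf_iff_isSheaf_comp (forget (ModuleCat.{u} R)) _).2
      (TopCat.Presheaf.toTypes_isSheaf Y fun y => F.presheaf.stalk y)⟩

variable {F : TopCat.Sheaf (ModuleCat.{u} R) Y}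

theorem isFlasque_godement : (godement F).IsFlasque := by
  rw [isFlasque_iff]
  intro U V h t
  classical
  refine ⟨fun y : V => if hy : y.1 ∈ U then (show ∀ y : U, F.presheaf.stalk y.1 from t) ⟨y.1, hy⟩
    else 0, funext fun y : U => ?_⟩
  exact dif_pos y.2

/-- The inclusion of a sheaf into its Godement sheaf. -/
def toGodement (F : TopCat.Sheaf (ModuleCat.{u} R) Y) : F ⟶ godement F :=
  ⟨{ app := fun U => ModuleCat.ofHom
      { toFun := fun t (y : (unop U : Opens Y)) => F.presheaf.germ (unop U) y.1 y.2 t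
        map_add' := fun _ _ => funext fun _ => map_add _ _ _
        map_smul' := fun _ _ => funext fun _ => map_smul _ _ _ }
     naturality := fun U V i => by
      ext t
      exact funext fun y => F.presheaf.germ_res_apply i.unop y.1 y.2 t }⟩

instance : Mono (toGodement F) := by
  refine mono_of_stalkMap_injective _ fun y => (injective_iff_map_eq_zero _).2 fun a ha => ?_
  obtain ⟨U, -, hy, t, rfl⟩ := exists_germ a (show y ∈ (⊤ : Opens Y) from trivial)
  rw [stalkMap_germ, ← map_zero ((godement F).presheaf.germ U y hy).hom] at ha
  obtain ⟨W, hyW, _, _, e⟩ := (godement F).presheaf.germ_eq y hy hy _ _ ha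
  exact congrFun e ⟨y, hyW⟩

/-- The endomorphism of the Godement sheaf given by a family of endomorphisms of stalks. -/
def godementEnd (e : ∀ y, F.presheaf.stalk y →ₗ[R] F.presheaf.stalk y) : godement F ⟶ godement F :=
  ⟨{ app := fun U => ModuleCat.ofHom
      { toFun := fun s (y : (unop U : Opens Y)) =>
          e y.1 ((show ∀ y : (unop U : Opens Y), F.presheaf.stalk y.1 from s) y)
        map_add' := fun _ _ => funext fun _ => map_add _ _ _
        map_smul' := fun _ _ => funext fun _ => map_smul _ _ _ }
     naturality := fun _ _ _ => rfl }⟩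

theorem toGodement_godementEnd (h : F ⟶ F) :
    toGodement F ≫ godementEnd (stalkMap h) = h ≫ toGodement F := by
  apply CategoryTheory.Sheaf.hom_ext
  ext U t
  exact funext fun y => stalkMap_germ h y.2 t

/-- Two sections of the Godement sheaf have the same germ if they agree nearby. -/
theorem godement_germ_congr {U V : Opens Y} {y : Y} (hU : y ∈ U) (hV : y ∈ V)
    (s : ∀ z : U, F.presheaf.stalk z.1) (t : ∀ z : V, F.presheaf.stalk z.1)
    (h : ∀ᶠ z in nhds y, ∀ (h₁ : z ∈ U) (h₂ : z ∈ V), s ⟨z, h₁⟩ = t ⟨z, h₂⟩) :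
    (godement F).presheaf.germ U y hU s = (godement F).presheaf.germ V y hV t := by
  obtain ⟨W, hW, hWo, hyW⟩ := mem_nhds_iff.1 h
  have h₁ : U ⊓ V ⊓ ⟨W, hWo⟩ ≤ U := inf_le_left.trans inf_le_left
  have h₂ : U ⊓ V ⊓ ⟨W, hWo⟩ ≤ V := inf_le_left.trans inf_le_right
  have hy : y ∈ U ⊓ V ⊓ ⟨W, hWo⟩ := ⟨⟨hU, hV⟩, hyW⟩
  refine (germ_res (F := godement F) h₁ hy s).symm.trans
    (Eq.trans ?_ (germ_res (F := godement F) h₂ hy t))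
  refine congrArg _ (funext fun z => ?_)
  exact hW z.2.2 (h₁ z.2) (h₂ z.2)

theorem stalkMap_godementEnd_eq_zero {e : ∀ y, F.presheaf.stalk y →ₗ[R] F.presheaf.stalk y} {y : Y}
    (h : ∀ᶠ z in nhds y, e z = 0) : stalkMap (godementEnd e) y = 0 := by
  ext a
  obtain ⟨U, -, hy, t, rfl⟩ := exists_germ a (show y ∈ (⊤ : Opens Y) from trivial)
  rw [stalkMap_germ]
  refine (godement_germ_congr hy hy _ 0 ?_).trans (map_zero _)
  filter_upwards [h] with z hz h₁ _
  show e z _ = 0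
  rw [hz]
  rfl

/-! ### Fine sheaves are acyclic for global sections. -/

section Fine

open Limits

/-- An endomorphism vanishes near the points outside its closed support. -/
theorem eventually_eq_zero {h : F ⟶ F} {y : Y} (hy : y ∉ closure {z | stalkEnd h z ≠ 0}) :
    ∀ᶠ z in nhds y, stalkMap h z = 0 := by
  filter_upwards [isClosed_closure.isOpen_compl.mem_nhds hy] with z hz
  by_contra hne
  exact hz (subset_closure hne)

theorem exists_finset_nhds {ι : Type u} {U : ι → Opens Y}
    (hU : LocallyFinite fun i => (U i : Set Y)) (y : Y) :
    ∃ T : Finset ι, ∀ᶠ z in nhds y, ∀ i, z ∈ U i → i ∈ T := by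
  obtain ⟨W, hW, hfin⟩ := hU y
  refine ⟨hfin.toFinset, ?_⟩
  filter_upwards [hW] with z hz i hzi
  exact hfin.mem_toFinset.2 ⟨z, hzi, hz⟩

theorem eq_zero_of_notMem {ι : Type u} {U : ι → Opens Y} {h : ι → (F ⟶ F)}
    (hs : ∀ i, closure {y | stalkEnd (h i) y ≠ 0} ⊆ (U i : Set Y)) {i : ι} {y : Y} (hy : y ∉ U i) :
    stalkMap (h i) y = 0 :=
  (eventually_eq_zero fun hy' => hy (hs i hy')).self_of_nhds

theorem finsum_stalkMap_eq_sum {ι : Type u} {U : ι → Opens Y} {h : ι → (F ⟶ F)}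
    (hs : ∀ i, closure {y | stalkEnd (h i) y ≠ 0} ⊆ (U i : Set Y)) {y : Y} {T : Finset ι}
    (hT : ∀ i, y ∈ U i → i ∈ T) (a : ι → F.presheaf.stalk y) :
    ∑ᶠ i, stalkMap (h i) y (a i) = ∑ i ∈ T, stalkMap (h i) y (a i) := by
  refine finsum_eq_sum_of_support_subset _ fun i hi => hT i ?_
  by_contra hy
  refine hi ?_
  show stalkMap (h i) y (a i) = 0
  rw [eq_zero_of_notMem hs hy]
  rfl

/-- A germ of the Godement sheaf depends on a whole neighbourhood, so the finite set `T` has to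
serve for all points near `y`. Local finiteness provides it. -/
theorem finsum_stalkMap_godementEnd {ι : Type u} {U : ι → Opens Y}
    (hU : LocallyFinite fun i => (U i : Set Y)) {h : ι → (F ⟶ F)}
    (hs : ∀ i, closure {y | stalkEnd (h i) y ≠ 0} ⊆ (U i : Set Y))
    (hsum : ∀ (y : Y) (a : F.presheaf.stalk y), ∑ᶠ i, stalkEnd (h i) y a = a)
    (y : Y) (a : (godement F).presheaf.stalk y) :
    ∃ T : Finset ι, (∀ i, i ∉ T → stalkMap (godementEnd (stalkMap (h i))) y = 0) ∧
      ∑ i ∈ T, stalkMap (godementEnd (stalkMap (h i))) y a = a := by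
  obtain ⟨T, hT⟩ := exists_finset_nhds hU y
  refine ⟨T, fun i hi => stalkMap_godementEnd_eq_zero ?_, ?_⟩
  · filter_upwards [hT] with z hz
    exact eq_zero_of_notMem hs fun h => hi (hz i h)
  · obtain ⟨V, -, hy, s, rfl⟩ := exists_germ a (show y ∈ (⊤ : Opens Y) from trivial)
    simp only [stalkMap_germ]
    refine (map_sum ((godement F).presheaf.germ V y hy).hom _ _).symm.trans ?_
    refine godement_germ_congr hy hy _ s ?_
    filter_upwards [hT] with z hz h₁ _
    refine (Finset.sum_apply _ _ _).trans ?_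
    exact (finsum_stalkMap_eq_sum hs hz fun _ => _).symm.trans (hsum z _)

/-- Applied stalk by stalk, the `h i` act on the Godement sheaf and preserve `F`, so they act on the
quotient. Supports do not grow, because an `h i` that vanishes near `y` acts as zero on germs at
`y`. -/
theorem isFine_cokernel_toGodement (hF : IsFine F) : IsFine (cokernel (toGodement F)) := by
  intro ι U hcov hU
  obtain ⟨h, hs, hsum⟩ := hF ι U hcov hU
  let k : ι → (cokernel (toGodement F) ⟶ cokernel (toGodement F)) := fun i =>
    cokernel.map (toGodement F) (toGodement F) (h i) (godementEnd (stalkMap (h i)))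
      (toGodement_godementEnd (h i))
  have hk : ∀ i y (a : (godement F).presheaf.stalk y),
      stalkMap (k i) y (stalkMap (cokernel.π (toGodement F)) y a) =
        stalkMap (cokernel.π (toGodement F)) y (stalkMap (godementEnd (stalkMap (h i))) y a) := by
    intro i y a
    rw [← stalkMap_comp, ← stalkMap_comp]
    congr 2
    exact cokernel.π_desc _ _ _
  refine ⟨k, fun i => ?_, fun y b => ?_⟩
  · refine (closure_minimal (fun y hy => ?_) isClosed_closure).trans (hs i)
    by_contra hy'
    refine hy (LinearMap.ext fun b => ?_)
    obtain ⟨a, rfl⟩ := stalkMap_surjective (cokernel.π (toGodement F)) y b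
    refine (hk i y a).trans ?_
    rw [stalkMap_godementEnd_eq_zero (eventually_eq_zero hy')]
    exact map_zero _
  · obtain ⟨a, rfl⟩ := stalkMap_surjective (cokernel.π (toGodement F)) y b
    obtain ⟨T, hT, hTa⟩ := finsum_stalkMap_godementEnd hU hs hsum y a
    refine (finsum_eq_sum_of_support_subset (s := T) _ fun i hi => ?_).trans ?_
    · by_contra hiT
      refine hi ((hk i y a).trans ?_)
      rw [hT i hiT]
      exact map_zero _
    · refine (Finset.sum_congr rfl fun i _ => hk i y a).trans ?_
      rw [← map_sum, hTa]

/-- If `X₁` is fine and `Y` is paracompact, then global sections of `X₃` lift to `X₂`. -/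
theorem section_surjective_of_isFine [ParacompactSpace Y]
    {S : ShortComplex (TopCat.Sheaf (ModuleCat.{u} R) Y)} (hS : S.ShortExact) (hF : IsFine S.X₁)
    (c : S.X₃.presheaf.obj (op ⊤)) : ∃ b : S.X₂.presheaf.obj (op ⊤), S.g.hom.app (op ⊤) b = c := by
  have := hS.mono_f
  have := hS.epi_g
  have hloc : ∀ y : Y, ∃ (V : Opens Y) (_ : y ∈ V) (b : S.X₂.presheaf.obj (op V)),
      ∀ (z : Y) (hz : z ∈ V), stalkMap S.g z (S.X₂.presheaf.germ V z hz b) =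
        S.X₃.presheaf.germ ⊤ z trivial c := by
    intro y
    obtain ⟨a, ha⟩ := stalkMap_surjective S.g y (S.X₃.presheaf.germ ⊤ y trivial c)
    obtain ⟨V, -, hy, b, rfl⟩ := exists_germ a (show y ∈ (⊤ : Opens Y) from trivial)
    rw [stalkMap_germ] at ha
    obtain ⟨W, hWV, hWT, hyW, e⟩ := exists_nhds_germ_eq (V := ⊤) hy trivial _ _ ha
    refine ⟨W, hyW, S.X₂.presheaf.map (homOfLE hWV).op b, fun z hz => ?_⟩
    rw [germ_res, stalkMap_germ]
    exact e z hz
  choose V hV b hb using hloc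
  obtain ⟨U', hU'o, hU'cov, hU'fin, hU'V⟩ := precise_refinement (fun y => (V y : Set Y))
    (fun y => (V y).isOpen) (Set.iUnion_eq_univ_iff.2 fun y => ⟨y, hV y⟩)
  let U : Y → Opens Y := fun i => ⟨U' i, hU'o i⟩
  obtain ⟨h, hs, hsum⟩ := hF Y U (by
    refine eq_top_iff.2 fun y _ => Opens.mem_iSup.2 ?_
    exact Set.mem_iUnion.1 (hU'cov.ge (Set.mem_univ y))) hU'fin
  -- the local lifts, extended by zero
  classical
  let β : Y → ∀ y : Y, S.X₂.presheaf.stalk y := fun i y =>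
    if hy : y ∈ U i then S.X₂.presheaf.germ (V i) y (hU'V i hy) (b i) else 0
  have hβ : ∀ i (y : Y) (hy : y ∈ U i), β i y = S.X₂.presheaf.germ (V i) y (hU'V i hy) (b i) :=
    fun i y hy => dif_pos hy
  have hgβ : ∀ i (y : Y), y ∈ U i → stalkMap S.g y (β i y) = S.X₃.presheaf.germ ⊤ y trivial c := by
    intro i y hy
    rw [hβ i y hy, hb]
  have hβs : ∀ i (y : Y), y ∈ U i → IsSectionAt S.X₂ (β i) y := by
    intro i y hy
    have hle : U i ≤ V i := hU'V i
    refine ⟨U i, hy, S.X₂.presheaf.map (homOfLE hle).op (b i), fun z hz => ?_⟩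
    exact (hβ i z hz).trans (germ_res hle hz (b i)).symm
  -- The differences of local lifts form a 1-cocycle `a i j` with values in `S.X₁`.
  have hex : ∀ i j (y : Y), ∃ a, y ∈ U i → y ∈ U j → stalkMap S.f y a = β i y - β j y := by
    intro i j y
    by_cases hy : y ∈ U i ∧ y ∈ U j
    · obtain ⟨a, ha⟩ := stalkMap_exact hS.exact y (β i y - β j y) (by
        rw [map_sub, hgβ i y hy.1, hgβ j y hy.2, sub_self])
      exact ⟨a, fun _ _ => ha⟩
    · exact ⟨0, fun h₁ h₂ => absurd ⟨h₁, h₂⟩ hy⟩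
  choose a ha using hex
  -- Although `a i j` is a section only on `U i ∩ U j`, its image under `h j` extends by zero to `U
  -- i`, because the closed support of `h j` lies in `U j`.
  have has : ∀ i j (y : Y), y ∈ U i → IsSectionAt S.X₁ (fun z => stalkMap (h j) z (a i j z)) y := by
    intro i j y hy
    by_cases hyj : y ∈ U j
    · refine IsSectionAt.map (IsSectionAt.of_map (f := S.f) ?_) (h j)
      refine ((hβs i y hy).sub (hβs j y hyj)).congr ?_
      filter_upwards [(U i).isOpen.mem_nhds hy, (U j).isOpen.mem_nhds hyj] with z hz hzj
      exact ha i j z hz hzj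
    · refine (IsSectionAt.zero S.X₁ y).congr ?_
      filter_upwards [eventually_eq_zero fun hy' => hyj (hs j hy')] with z hz
      rw [hz]
      rfl
  -- The cocycle is the coboundary of `∑ j, h j (a i j)`, since `∑ j, h j (a i j - a i' j) = ∑ j, h
  -- j (a i i') = a i i'`. Subtracting this sum makes the lifts agree on overlaps.
  let γ : Y → ∀ y : Y, S.X₂.presheaf.stalk y := fun i y =>
    β i y - stalkMap S.f y (∑ᶠ j, stalkMap (h j) y (a i j y))
  have hγs : ∀ i (y : Y), y ∈ U i → IsSectionAt S.X₂ (γ i) y := by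
    intro i y hy
    refine (hβs i y hy).sub (IsSectionAt.map ?_ S.f)
    obtain ⟨T, hT⟩ := exists_finset_nhds (U := U) hU'fin y
    refine (IsSectionAt.sum T fun j _ => has i j y hy).congr ?_
    filter_upwards [hT] with z hz
    exact finsum_stalkMap_eq_sum hs hz _
  have hγ : ∀ i i' (y : Y), y ∈ U i → y ∈ U i' → γ i y = γ i' y := by
    intro i i' y hy hy'
    obtain ⟨T, hT⟩ := exists_finset_nhds (U := U) hU'fin y
    have hT := hT.self_of_nhds
    have hterm : ∀ j, stalkMap (h j) y (a i j y) - stalkMap (h j) y (a i' j y) =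
        stalkMap (h j) y (a i i' y) := by
      intro j
      by_cases hyj : y ∈ U j
      · rw [← map_sub]
        congr 1
        apply stalkMap_injective S.f y
        rw [map_sub, ha i j y hy hyj, ha i' j y hy' hyj, ha i i' y hy hy']
        abel
      · rw [eq_zero_of_notMem hs hyj]
        exact sub_self _
    have : ∑ᶠ j, stalkMap (h j) y (a i j y) - ∑ᶠ j, stalkMap (h j) y (a i' j y) = a i i' y := by
      rw [finsum_stalkMap_eq_sum hs hT, finsum_stalkMap_eq_sum hs hT, ← Finset.sum_sub_distrib,
        Finset.sum_congr rfl fun j _ => hterm j, ← finsum_stalkMap_eq_sum hs hT fun _ => a i i' y]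
      exact hsum y _
    have h₂ := ha i i' y hy hy'
    rw [← this, map_sub] at h₂
    rw [← sub_eq_zero] at h₂ ⊢
    rw [← neg_eq_zero, ← h₂]
    simp only [γ]
    abel
  choose i hi using fun y => Set.mem_iUnion.1 (hU'cov.ge (Set.mem_univ y))
  have hsec : IsLocallySection S.X₂ ⊤ fun y => γ (i y) y := by
    intro y _
    refine (hγs (i y) y (hi y)).congr ?_
    filter_upwards [(hU'o (i y)).mem_nhds (hi y)] with z hz
    exact hγ _ _ z (hi z) hz
  obtain ⟨t, ht⟩ := hsec.exists_section
  refine ⟨t, section_ext fun y _ => ?_⟩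
  refine (stalkMap_germ S.g (U := ⊤) trivial t).symm.trans ?_
  refine (congrArg (stalkMap S.g y) (ht y trivial)).trans ?_
  simp only [γ]
  rw [map_sub, hgβ (i y) y (hi y), stalkMap_comp_eq_zero, sub_zero]

/-- The Godement sheaf is flasque, hence acyclic, and the quotient by a fine sheaf is fine again, so
dimension shifting stays within the fine sheaves. -/
theorem acyclic_of_isFine [ParacompactSpace Y] (hF : IsFine F) :
    Acyclic (globalSections R Y) F := by
  refine acyclic_of_class (globalSections R Y) IsFine (fun A hA => ?_) F hF
  have hS := shortExact_cokernel (toGodement A)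
  exact ⟨_, hS, rfl, acyclic_of_isFlasque isFlasque_godement, isFine_cokernel_toGodement hA,
    section_surjective_of_isFine hS hA⟩

end Fine

end Godement

end

end HigherOrder

namespace HigherOrder

noncomputable section

/-! ### Transfer of acyclicity to `H_q^0(Y, C, ·)`. -/

section Transfer

open Limits

variable {R : Type u} [CommRing R] {Y : TopCat.{u}} {X : Type u} [TopologicalSpace X]

theorem Acyclic.of_natIso {T T' : TopCat.Sheaf (ModuleCat.{u} R) Y ⥤ ModuleCat.{u} R} [T.Additive]
    [T'.Additive] (e : T ≅ T') {F : TopCat.Sheaf (ModuleCat.{u} R) Y} (h : Acyclic T F) :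
    Acyclic T' F :=
  fun p => (h p).of_iso ((rightDerivedIso e (p + 1)).symm.app F)

instance {C : Type u} (π : C(X, Y)) (ρ : X → C) (q : ℕ) :
    PreservesFiniteLimits (sheafH0 R π ρ q) :=
  preservesFiniteLimits_of_natIso (sheafH0Iso π ρ q).symm

theorem acyclic_sheafH0 {C : Type u} {π : C(X, Y)} (hπ : IsPrincipalCovering π) (ρ : X → C) {q : ℕ}
    (hq : 1 ≤ q)
    (hfree : ∀ k, 1 ≤ k → k < q → Module.Free R (gradedJ R (deckOver π ρ) k))
    {F : TopCat.Sheaf (ModuleCat.{u} R) Y} (hF : Acyclic (globalSections R Y) F) :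
    Acyclic (sheafH0 R π ρ q) F :=
  (acyclic_annihilatedSections hπ (deckOver π ρ) hq hfree
    (hF.of_natIso (globalSectionsIso hπ (deckOver π ρ)))).of_natIso (sheafH0Iso π ρ q).symm

end Transfer

end

end HigherOrder

theorem mainTheorem7 (R : Type u) [CommRing R]
    (Y : TopCat.{u}) [PathConnectedSpace Y] (hY : HigherOrder.LocallySimplyConnected Y)
    {X : Type u} [TopologicalSpace X] (π : C(X, Y)) (hπ : HigherOrder.IsUniversalCovering π)
    (hX : ContractibleSpace X)
    {C : Type u} [TopologicalSpace C] (κ : C(C, Y)) (hκ : HigherOrder.IsNormalCovering κ)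
    (ρ : C(X, C)) (hρ : ∀ x, κ (ρ x) = π x) :
    (∀ p : ℕ, Nonempty ((HigherOrder.sheafH0 R π ρ 1).rightDerived p ≅
      (HigherOrder.globalSections R Y).rightDerived p)) ∧
    (∀ q : ℕ, 1 ≤ q →
      (∀ k : ℕ, 1 ≤ k → k < q →
        Module.Free R (HigherOrder.gradedJ R (HigherOrder.deckOver π ρ) k)) →
      (∀ F : TopCat.Sheaf (ModuleCat.{u} R) Y,
        HigherOrder.IsAcyclicFor (HigherOrder.globalSections R Y) F →
          HigherOrder.IsAcyclicFor (HigherOrder.sheafH0 R π ρ q) F) ∧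
      (∀ (F : TopCat.Sheaf (ModuleCat.{u} R) Y)
        (K : CochainComplex (TopCat.Sheaf (ModuleCat.{u} R) Y) ℕ)
        (ε : (CochainComplex.single₀ (TopCat.Sheaf (ModuleCat.{u} R) Y)).obj F ⟶ K),
        QuasiIso ε →
        ((∀ n, (K.X n).IsFlasque) ∨
          (T2Space Y ∧ ParacompactSpace Y ∧ ∀ n, HigherOrder.IsFine (K.X n))) →
        ∀ p : ℕ, Nonempty (((HigherOrder.sheafH0 R π ρ q).rightDerived p).obj F ≅
          (((HigherOrder.sheafH0 R π ρ q).mapHomologicalComplex (ComplexShape.up ℕ)).obj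
            K).homology p))) := by
  have hc := hπ.isPrincipalCovering hY
  -- For `q = 1` the two functors are isomorphic, so their derived functors are isomorphic,
  -- naturally in the sheaf.
  refine ⟨fun p => ⟨HigherOrder.rightDerivedIso ((HigherOrder.sheafH0Iso π ρ 1).trans
    (HigherOrder.globalSectionsIso hc (HigherOrder.deckOver π ρ)).symm) p⟩,
    fun q hq hfree => ⟨fun F hF => ?_, fun F K ε hε hK p => ?_⟩⟩
  · exact (HigherOrder.isAcyclicFor_iff _ F).2
      (HigherOrder.acyclic_sheafH0 hc ρ hq hfree ((HigherOrder.isAcyclicFor_iff _ F).1 hF))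
  · refine HigherOrder.rightDerived_iso_homology _ K (fun n => ?_) ε hε p
    refine HigherOrder.acyclic_sheafH0 hc ρ hq hfree ?_
    rcases hK with hK | ⟨-, _, hK⟩
    · exact HigherOrder.acyclic_of_isFlasque (hK n)
    · exact HigherOrder.acyclic_of_isFine (hK n)
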